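/- Model. Let $\mathcal X,\mathcal Y,\mathcal Z$ be finite sets, $\mathcal X,\mathcal Y$ non-empty. A (two-party) quantum communication protocol $\Pi$ with classical inputs $x\in\mathcal X$ (Alice) and $y\in\mathcal Y$ (Bob) has an odd number $k$ of rounds and finite-dimensional registers: private memories $A_i$ (Alice), $B_i$ (Bob) and message registers $M_i$, all initially in a fixed basis state. In each odd round $i$ Alice applies to her memory and the message register a local unitary operation (possibly with fresh ancillas, i.e. an isometry) depending on $x$, obtains $A_iM_i$ and sends $M_i$ to Bob; in each even round Bob does the same with his memory, depending on $y$, and sends $M_i$ to Alice. After round $k$ Bob applies a last such operation and measures an output register by a POVM with outcomes in $\mathcal Z$; $\Pi_{out}(x,y)$ denotes his random output. In a protocol with private classical coins, Alice and Bob moreover hold finite strings $R_A$, $R_B$ of independent fair coin flips, independent of the inputs, and each player's operations may depend on that player's coins, which stay available in all rounds. A protocol is memoryless if all private quantum registers $A_i,B_i$ are empty (one-dimensional), so that in every round the sender sends all quantum registers held. For an input distribution $\mu$ on $\mathcal X\times\mathcal Y$, with $(X,Y)\sim\mu$, the classical input information cost is $$\mathrm{CIC}_\mu(\Pi)=\sum_{i\le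 k,\ i\text{ odd}} I(M_i:X\mid Y,R_B,B_i)+\sum_{i\le k,\ i\text{ even}} I(M_i:Y\mid X,R_A,A_i),$$ where the quantum conditional mutual information is that of the joint state of all registers after round $i$, with $I(A:B)=S(A)+S(B)-S(AB)$, $I(A:B\mid C)=I(A:BC)-I(A:C)$, and $S$ the von Neumann entropy. Theorem. For every quantum communication protocol $\Pi$ (with or without private coins) there is a memoryless quantum protocol $\Pi'$ with private classical coins, all of whose local operations are unitary, such that 1. on every input pair $(x,y)$, $\Pi'$ has the same output distribution as $\Pi$; 2. for every input distribution $\mu$, $$\mathrm{CIC}_\mu(\Pi')=I\big(\Pi_{out}(X,Y):X\mid Y\big),$$ where $(X,Y)\sim\mu$ and $I$ on the right is the classical conditional mutual information (all logarithms to the same base). -/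

import Mathlib

open scoped Matrix ComplexOrder

namespace QComm

/-! ### Entropy and mutual information -/

/-- Shannon entropy of a finite distribution (natural logarithm). -/
noncomputable def shannonEntropy {α : Type*} [Fintype α] (p : α → ℝ) : ℝ :=
  ∑ a, Real.negMulLog (p a)

/-- Classical mutual information `I(A : B) = H(A) + H(B) - H(AB)`. -/
noncomputable def classicalMutualInfo {α β : Type*} [Fintype α] [Fintype β]
    (p : α × β → ℝ) : ℝ :=
  shannonEntropy (fun a => ∑ b, p (a, b)) + shannonEntropy (fun b => ∑ a, p (a, b))
    - shannonEntropy p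

/-- Classical conditional mutual information `I(A : B | C) = I(A : BC) - I(A : C)`. -/
noncomputable def classicalCondMutualInfo {α β γ : Type*} [Fintype α] [Fintype β] [Fintype γ]
    (p : α × β × γ → ℝ) : ℝ :=
  classicalMutualInfo p
    - classicalMutualInfo (fun s : α × γ => ∑ b, p (s.1, b, s.2))

/-- Von Neumann entropy `-Tr(ρ log ρ)` of a density matrix, i.e. the Shannon entropy of its
eigenvalues (natural logarithm; the value `0` for a non-Hermitian matrix is never used). -/
noncomputable def vonNeumannEntropy {α : Type*} [Fintype α] [DecidableEq α]
    (ρ : Matrix α α ℂ) : ℝ :=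
  open scoped Classical in
  if h : ρ.IsHermitian then shannonEntropy h.eigenvalues else 0

/-- Partial trace over the second register. -/
noncomputable def traceRight {α β : Type*} [Fintype β]
    (ρ : Matrix (α × β) (α × β) ℂ) : Matrix α α ℂ :=
  Matrix.of fun a a' => ∑ b, ρ (a, b) (a', b)

/-- Partial trace over the first register. -/
noncomputable def traceLeft {α β : Type*} [Fintype α]
    (ρ : Matrix (α × β) (α × β) ℂ) : Matrix β β ℂ :=
  Matrix.of fun b b' => ∑ a, ρ (a, b) (a, b')

/-- Quantum mutual information `I(A : B) = S(A) + S(B) - S(AB)`. -/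
noncomputable def mutualInfo {α β : Type*} [Fintype α] [DecidableEq α] [Fintype β]
    [DecidableEq β] (ρ : Matrix (α × β) (α × β) ℂ) : ℝ :=
  vonNeumannEntropy (traceRight ρ) + vonNeumannEntropy (traceLeft ρ) - vonNeumannEntropy ρ

/-- Quantum conditional mutual information `I(A : B | C) = I(A : BC) - I(A : C)`. -/
noncomputable def condMutualInfo {α β γ : Type*} [Fintype α] [DecidableEq α] [Fintype β]
    [DecidableEq β] [Fintype γ] [DecidableEq γ]
    (ρ : Matrix (α × β × γ) (α × β × γ) ℂ) : ℝ :=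
  mutualInfo ρ
    - mutualInfo (Matrix.of fun s t : α × γ => ∑ b, ρ (s.1, b, s.2) (t.1, b, t.2))

/-- The classical-quantum state `∑ c, w c • |c⟩⟨c| ⊗ |ψ c⟩⟨ψ c|`. -/
noncomputable def cqState {κ α : Type*} [DecidableEq κ] (w : κ → ℝ) (ψ : κ → α → ℂ) :
    Matrix (κ × α) (κ × α) ℂ :=
  Matrix.of fun s t => if s.1 = t.1 then (w s.1 : ℂ) * (ψ s.1 s.2 * star (ψ t.1 t.2)) else 0

/-! ### Two-party quantum protocols with classical inputs -/

/-- A quantum communication protocol with classical inputs `x : X`, `y : Y`, private classical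
coins and output of Bob in `Z`. There are `k = 2 * n + 1` rounds; Alice speaks in the odd ones.
`M i` is the message register sent in round `i` (`M 0` is the initial message register), `A j` is
Alice's private memory after her `j`-th turn (so it is her memory from round `2 * j - 1` to round
`2 * j`), and `B j` is Bob's private memory after his `j`-th turn (from round `2 * j` to round
`2 * j + 1`). A register is given by the finite type that labels its computational basis.
Alice holds `cA` and Bob `cB` fair coins; all coins of a player may be used at each of their turns.
A protocol without coins is the case `cA = cB = 0`. Local operations are isometries (unitaries
preceded by the introduction of fresh ancillas). -/
structure Protocol (X Y Z : Type*) [Fintype Z] where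
  n : ℕ
  cA : ℕ
  cB : ℕ
  A : ℕ → Type
  B : ℕ → Type
  M : ℕ → Type
  [fintypeA : ∀ j, Fintype (A j)]
  [fintypeB : ∀ j, Fintype (B j)]
  [fintypeM : ∀ i, Fintype (M i)]
  [decEqA : ∀ j, DecidableEq (A j)]
  [decEqB : ∀ j, DecidableEq (B j)]
  [decEqM : ∀ i, DecidableEq (M i)]
  /-- The registers start in the basis state `|a₀⟩|m₀⟩|b₀⟩`. -/
  a₀ : A 0
  m₀ : M 0
  b₀ : B 0
  /-- Alice's operation in round `2 * j + 1`, controlled by her input and her coins. -/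
  UA : ∀ j, X → (Fin cA → Bool) → Matrix (A (j + 1) × M (2 * j + 1)) (A j × M (2 * j)) ℂ
  /-- Bob's operation in round `2 * j + 2`, controlled by his input and his coins. -/
  UB : ∀ j, Y → (Fin cB → Bool) → Matrix (M (2 * j + 2) × B (j + 1)) (M (2 * j + 1) × B j) ℂ
  UA_isometry : ∀ j x r, (UA j x r)ᴴ * UA j x r = 1
  UB_isometry : ∀ j y r, (UB j y r)ᴴ * UB j y r = 1
  /-- Bob's garbage register and output register after his last operation. -/
  G : Type
  O : Type
  [fintypeG : Fintype G]
  [fintypeO : Fintype O]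
  [decEqG : DecidableEq G]
  [decEqO : DecidableEq O]
  /-- Bob's operation after the last round. -/
  UF : Y → (Fin cB → Bool) → Matrix (G × O) (M (2 * n + 1) × B n) ℂ
  UF_isometry : ∀ y r, (UF y r)ᴴ * UF y r = 1
  /-- The POVM by which Bob obtains his output from the register `O`. -/
  E : Z → Matrix O O ℂ
  E_posSemidef : ∀ z, (E z).PosSemidef
  E_sum : ∑ z, E z = 1

attribute [instance] Protocol.fintypeA Protocol.fintypeB Protocol.fintypeM Protocol.decEqA
  Protocol.decEqB Protocol.decEqM Protocol.fintypeG Protocol.fintypeO Protocol.decEqG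
  Protocol.decEqO

/-- Alice's operation `V ⊗ 1` on a state of the registers `A, M, B`. -/
noncomputable def applyAlice {α α' μ μ' β : Type*} [Fintype α] [Fintype μ]
    (V : Matrix (α' × μ') (α × μ) ℂ) (ψ : α × μ × β → ℂ) : α' × μ' × β → ℂ :=
  fun s => ∑ p : α × μ, V (s.1, s.2.1) p * ψ (p.1, p.2, s.2.2)

/-- Bob's operation `1 ⊗ V` on a state of the registers `A, M, B`. -/
noncomputable def applyBob {α μ μ' β β' : Type*} [Fintype μ] [Fintype β]
    (V : Matrix (μ' × β') (μ × β) ℂ) (ψ : α × μ × β → ℂ) : α × μ' × β' → ℂ :=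
  fun s => ∑ p : μ × β, V s.2 p * ψ (s.1, p)

namespace Protocol

variable {X Y Z : Type*} [Fintype Z]

/-- The private coins of Alice. -/
abbrev RA (Q : Protocol X Y Z) : Type := Fin Q.cA → Bool

/-- The private coins of Bob. -/
abbrev RB (Q : Protocol X Y Z) : Type := Fin Q.cB → Bool

/-- The joint pure state of `A, M, B` after `2 * j` rounds, for given inputs and coins. -/
noncomputable def evenState (Q : Protocol X Y Z) (x : X) (y : Y) (rA : Q.RA) (rB : Q.RB) :
    (j : ℕ) → Q.A j × Q.M (2 * j) × Q.B j → ℂ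
  | 0 => Pi.single (Q.a₀, Q.m₀, Q.b₀) 1
  | j + 1 => applyBob (Q.UB j y rB) (applyAlice (Q.UA j x rA) (Q.evenState x y rA rB j))

/-- The joint pure state of `A, M, B` after `2 * j + 1` rounds, for given inputs and coins. -/
noncomputable def oddState (Q : Protocol X Y Z) (x : X) (y : Y) (rA : Q.RA) (rB : Q.RB)
    (j : ℕ) : Q.A (j + 1) × Q.M (2 * j + 1) × Q.B j → ℂ :=
  applyAlice (Q.UA j x rA) (Q.evenState x y rA rB j)

/-- The joint pure state of `A, G, O` after Bob's last operation. -/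
noncomputable def finalState (Q : Protocol X Y Z) (x : X) (y : Y) (rA : Q.RA) (rB : Q.RB) :
    Q.A (Q.n + 1) × Q.G × Q.O → ℂ :=
  applyBob (Q.UF y rB) (Q.oddState x y rA rB Q.n)

/-- The probability that Bob outputs `z` on input `(x, y)`: the average over the coins of
`Tr((1 ⊗ E z) |φ⟩⟨φ|)`, where `φ` is the final state. -/
noncomputable def outProb (Q : Protocol X Y Z) (x : X) (y : Y) (z : Z) : ℝ :=
  (∑ rA : Q.RA, ∑ rB : Q.RB, ∑ a : Q.A (Q.n + 1), ∑ g : Q.G,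
    (star (fun o => Q.finalState x y rA rB (a, g, o)) ⬝ᵥ
      (Q.E z *ᵥ fun o => Q.finalState x y rA rB (a, g, o))).re) / (2 ^ Q.cA * 2 ^ Q.cB)

/-- The joint distribution of `(Π_out(X, Y), X, Y)` for inputs distributed according to `μ`. -/
noncomputable def outJoint (Q : Protocol X Y Z) (μ : X × Y → ℝ) : Z × X × Y → ℝ :=
  fun s => μ s.2 * Q.outProb s.2.1 s.2.2 s.1

/-- The joint distribution of inputs and coins. -/
noncomputable def weight (Q : Protocol X Y Z) (μ : X × Y → ℝ) :
    X × Y × Q.RA × Q.RB → ℝ :=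
  fun c => μ (c.1, c.2.1) / (2 ^ Q.cA * 2 ^ Q.cB)

section CIC

variable [Fintype X] [DecidableEq X] [Fintype Y] [DecidableEq Y]

/-- The global state of all registers `X, Y, R_A, R_B, A, M, B` after round `2 * j + 1`. -/
noncomputable def oddRho (Q : Protocol X Y Z) (μ : X × Y → ℝ) (j : ℕ) :
    Matrix ((X × Y × Q.RA × Q.RB) × Q.A (j + 1) × Q.M (2 * j + 1) × Q.B j)
      ((X × Y × Q.RA × Q.RB) × Q.A (j + 1) × Q.M (2 * j + 1) × Q.B j) ℂ :=
  cqState (Q.weight μ) fun c => Q.oddState c.1 c.2.1 c.2.2.1 c.2.2.2 j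

/-- The global state of all registers `X, Y, R_A, R_B, A, M, B` after round `2 * j`. -/
noncomputable def evenRho (Q : Protocol X Y Z) (μ : X × Y → ℝ) (j : ℕ) :
    Matrix ((X × Y × Q.RA × Q.RB) × Q.A j × Q.M (2 * j) × Q.B j)
      ((X × Y × Q.RA × Q.RB) × Q.A j × Q.M (2 * j) × Q.B j) ℂ :=
  cqState (Q.weight μ) fun c => Q.evenState c.1 c.2.1 c.2.2.1 c.2.2.2 j

/-- `I(M_i : X | Y, R_B, B_i)` for the odd round `i = 2 * j + 1`. -/
noncomputable def oddTerm (Q : Protocol X Y Z) (μ : X × Y → ℝ) (j : ℕ) : ℝ :=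
  let e : (Q.M (2 * j + 1) × X × (Y × Q.RB × Q.B j)) × (Q.RA × Q.A (j + 1)) →
      (X × Y × Q.RA × Q.RB) × Q.A (j + 1) × Q.M (2 * j + 1) × Q.B j :=
    fun ⟨⟨m, x, y, rB, b⟩, rA, a⟩ => ((x, y, rA, rB), a, m, b)
  condMutualInfo (traceRight ((Q.oddRho μ j).submatrix e e))

/-- `I(M_i : Y | X, R_A, A_i)` for the even round `i = 2 * j`. -/
noncomputable def evenTerm (Q : Protocol X Y Z) (μ : X × Y → ℝ) (j : ℕ) : ℝ :=
  let e : (Q.M (2 * j) × Y × (X × Q.RA × Q.A j)) × (Q.RB × Q.B j) →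
      (X × Y × Q.RA × Q.RB) × Q.A j × Q.M (2 * j) × Q.B j :=
    fun ⟨⟨m, y, x, rA, a⟩, rB, b⟩ => ((x, y, rA, rB), a, m, b)
  condMutualInfo (traceRight ((Q.evenRho μ j).submatrix e e))

/-- The classical input information cost of the protocol for the input distribution `μ`: the sum
of the terms of the odd rounds `1, 3, …, 2 * n + 1` and of the even rounds `2, 4, …, 2 * n`. -/
noncomputable def CIC (Q : Protocol X Y Z) (μ : X × Y → ℝ) : ℝ :=
  ∑ j ∈ Finset.range (Q.n + 1), Q.oddTerm μ j + ∑ j ∈ Finset.range Q.n, Q.evenTerm μ (j + 1)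

end CIC

/-- A protocol is memoryless if the private quantum registers of both players are always empty
(that is, one-dimensional). -/
def Memoryless (Q : Protocol X Y Z) : Prop :=
  (∀ j, Fintype.card (Q.A j) = 1) ∧ ∀ j, Fintype.card (Q.B j) = 1

/-- All local operations are unitary (not only isometric). -/
def IsUnitary (Q : Protocol X Y Z) : Prop :=
  (∀ j x r, Q.UA j x r * (Q.UA j x r)ᴴ = 1) ∧ (∀ j y r, Q.UB j y r * (Q.UB j y r)ᴴ = 1) ∧
    ∀ y r, Q.UF y r * (Q.UF y r)ᴴ = 1

end Protocol

end QComm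

/-! Only the output kernel p(z | x, y) of the given protocol matters: every stochastic kernel is
computed by a memoryless protocol that reveals nothing but the sample
(`exists_memoryless_protocol`). The message register is a Clifford algebra with one distinguished
generator e_f and one generator e_z for each outcome z; its basis elements are labelled by words
over `ZMod 2`. The computation acts by left multiplication, the hiding by right multiplication, and
the two commute.

Computation: for the unit vector c = ∑ √p(z | x, y) e_z the rotor R = (1 + c e_f)/√2 is unitary and
e_f R e_f R† = R†R† = e_f c (`rotor_commutator`). Alice goes through all possible y and applies R†
and then R for each. Bob follows both with e_f if this y is his input; otherwise he does nothing and
the pair cancels. The total product is therefore e_f c for the true inputs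
(`run_aliceRotor_bobGen`). Applied to the empty word, it gives a superposition of distinct words,
one for each z, with squared amplitudes p(z | x, y).

Hiding: at their first turns Alice and Bob multiply on the right by random basis elements u and v.
Averaged over the sender's coins, the message is maximally mixed, whatever the inputs and the
receiver's coins (`sum_mask_average`), so all terms of the cost before the last round vanish. In the
last round Alice removes u, which costs only a global sign, and reuses the same coins for random
phases. What Bob receives is a classical mixture of outcome words shifted by v
(`last_message_apply`). He knows v, so the last term is the information in the outcome itself
(`classicalCondMutualInfo_relabel`). -/

namespace QComm

/-! ### Entropies of diagonal states and classical conditional information -/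

section Entropy

theorem vonNeumannEntropy_diagonal {α : Type*} [Fintype α] [DecidableEq α] (p : α → ℝ) :
    vonNeumannEntropy (Matrix.diagonal fun a => (p a : ℂ)) = shannonEntropy p := by
  have h : (Matrix.diagonal fun a => (p a : ℂ)).IsHermitian :=
    Matrix.isHermitian_diagonal_of_self_adjoint _ (by ext a; simp)
  unfold vonNeumannEntropy
  rw [dif_pos h]
  -- The eigenvalues come in an order unrelated to that of `p`, so the two families are compared as
  -- multisets of roots of the characteristic polynomial.
  have h1 := h.roots_charpoly_eq_eigenvalues
  have h0 : (∏ i, (Polynomial.X - Polynomial.C (p i : ℂ))).roots =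
      Multiset.map (fun i => (p i : ℂ)) Finset.univ.val := by
    rw [← Polynomial.roots_multiset_prod_X_sub_C 
      (Multiset.map (fun i => (p i : ℂ)) Finset.univ.val), Multiset.map_map]
    rfl
  rw [Matrix.charpoly_diagonal, h0] at h1
  have h2 := congrArg (Multiset.map fun c : ℂ => Real.negMulLog c.re) h1
  simp only [Multiset.map_map] at h2
  have h3 := congrArg Multiset.sum h2
  exact h3.symm

theorem traceRight_diagonal {α β : Type*} [Fintype β] [DecidableEq α] [DecidableEq β]
    (p : α × β → ℝ) :
    traceRight (Matrix.diagonal fun s => (p s : ℂ)) =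
      Matrix.diagonal fun a => ((∑ b, p (a, b) : ℝ) : ℂ) := by
  ext a a'
  by_cases h : a = a'
  · subst h; simp [traceRight]
  · simp [traceRight, h, Matrix.diagonal_apply]

theorem traceLeft_diagonal {α β : Type*} [Fintype α] [DecidableEq α] [DecidableEq β]
    (p : α × β → ℝ) :
    traceLeft (Matrix.diagonal fun s => (p s : ℂ)) =
      Matrix.diagonal fun b => ((∑ a, p (a, b) : ℝ) : ℂ) := by
  ext a a'
  by_cases h : a = a'
  · subst h; simp [traceLeft]
  · simp [traceLeft, h, Matrix.diagonal_apply]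

theorem mutualInfo_diagonal {α β : Type*} [Fintype α] [Fintype β]
    [DecidableEq α] [DecidableEq β] (p : α × β → ℝ) :
    mutualInfo (Matrix.diagonal fun s => (p s : ℂ)) = classicalMutualInfo p := by
  rw [mutualInfo, traceRight_diagonal, traceLeft_diagonal, vonNeumannEntropy_diagonal,
    vonNeumannEntropy_diagonal, vonNeumannEntropy_diagonal, classicalMutualInfo]

theorem condMutualInfo_diagonal {α β γ : Type*} [Fintype α] [Fintype β] [Fintype γ]
    [DecidableEq α] [DecidableEq β] [DecidableEq γ]
    (p : α × β × γ → ℝ) :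
    condMutualInfo (Matrix.diagonal fun s => (p s : ℂ)) = classicalCondMutualInfo p := by
  have h : (Matrix.of fun s t : α × γ => ∑ b,
      (Matrix.diagonal fun s => (p s : ℂ)) (s.1, b, s.2) (t.1, b, t.2)) =
      Matrix.diagonal fun s : α × γ => ((∑ b, p (s.1, b, s.2) : ℝ) : ℂ) := by
    ext s t
    by_cases h : s = t
    · subst h; simp
    · have h' : s.1 = t.1 → ¬ s.2 = t.2 := fun h1 h2 => h (Prod.ext h1 h2)
      simp only [Matrix.of_apply, Matrix.diagonal_apply, Prod.mk.injEq, true_and, if_neg h]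
      refine Finset.sum_eq_zero fun b _ => if_neg fun e => h' e.1 e.2
  rw [condMutualInfo, mutualInfo_diagonal, h, mutualInfo_diagonal, classicalCondMutualInfo]

theorem classicalCondMutualInfo_eq {α β γ : Type*} [Fintype α] [Fintype β] [Fintype γ]
    (p : α × β × γ → ℝ) :
    classicalCondMutualInfo p =
      shannonEntropy (fun s : β × γ => ∑ a, p (a, s))
        + shannonEntropy (fun s : α × γ => ∑ b, p (s.1, b, s.2))
        - shannonEntropy (fun c => ∑ a, ∑ b, p (a, b, c)) - shannonEntropy p := by
  have h : (fun a => ∑ s : β × γ, p (a, s)) = fun a => ∑ c, ∑ b, p (a, b, c) := by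
    funext a
    rw [Fintype.sum_prod_type, Finset.sum_comm]
  simp only [classicalCondMutualInfo, classicalMutualInfo, h]
  ring

theorem shannonEntropy_mul {α β : Type*} [Fintype α] [Fintype β]
    (u : α → ℝ) (q : β → ℝ) :
    shannonEntropy (fun s : α × β => u s.1 * q s.2) =
      (∑ b, q b) * shannonEntropy u + (∑ a, u a) * shannonEntropy q := by
  simp only [shannonEntropy, Real.negMulLog_mul, Fintype.sum_prod_type, Finset.sum_add_distrib,
    Finset.sum_mul_sum]
  rw [Finset.sum_comm]

/-- The two joint entropies that contain the first variable have opposite signs and split off the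
same multiple of the entropy of `u`. Hence `q` may have any total mass. -/
theorem classicalCondMutualInfo_of_indep {α β γ : Type*} [Fintype α] [Fintype β] [Fintype γ]
    (u : α → ℝ) (hu : ∑ a, u a = 1) (q : β × γ → ℝ) :
    classicalCondMutualInfo (fun s : α × β × γ => u s.1 * q s.2) = 0 := by
  rw [classicalCondMutualInfo_eq]
  simp only [← Finset.mul_sum, ← Finset.sum_mul, hu, one_mul]
  rw [shannonEntropy_mul u q, shannonEntropy_mul u (fun c => ∑ b, q (b, c)), hu,
    Fintype.sum_prod_type q, Finset.sum_comm]
  ring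

/-- Injectivity leaves at most one nonzero summand for each `m`, and `Real.negMulLog` vanishes at
`0`. -/
theorem negMulLog_sum_ite_injective {α β : Type*} [Fintype α] [Fintype β]
    [DecidableEq β] {g : α → β}
    (hg : Function.Injective g) (t : α → ℝ) (κ : ℝ) :
    ∑ m, Real.negMulLog (κ * ∑ z, if m = g z then t z else 0) =
      ∑ z, Real.negMulLog (κ * t z) := by
  have h : ∀ m, Real.negMulLog (κ * ∑ z, if m = g z then t z else 0) =
      ∑ z, if m = g z then Real.negMulLog (κ * t z) else 0 := by
    intro m
    by_cases hm : ∃ z, g z = m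
    · obtain ⟨z, rfl⟩ := hm
      classical
      simp [hg.eq_iff]
    · have : ∀ z, ¬ m = g z := fun z hz => hm ⟨z, hz.symm⟩
      simp [this]
  simp only [h]
  rw [Finset.sum_comm]
  simp

/-- Conditional mutual information is unchanged if the first variable is relabelled injectively,
depending on an independent uniform variable on which one also conditions. -/
theorem classicalCondMutualInfo_relabel {α β γ : Type*} [Fintype α] [Fintype β] [Fintype γ]
    {σ τ δ : Type*} [Fintype σ] [Nonempty σ] [Fintype τ]
    [DecidableEq τ] [Fintype δ] [Unique δ] (q : α × β × γ → ℝ) {g : σ → α → τ}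
    (hg : ∀ r, Function.Injective (g r)) :
    classicalCondMutualInfo (fun s : τ × β × (γ × σ × δ) => (Fintype.card σ : ℝ)⁻¹ *
      ∑ a, if s.1 = g s.2.2.2.1 a then q (a, s.2.1, s.2.2.1) else 0) =
      classicalCondMutualInfo q := by
  have hσ : (Fintype.card σ : ℝ) ≠ 0 := by simp
  -- Each of the four entropies grows by the total mass of `q` times `card σ * negMulLog κ`. Two
  -- enter with a plus sign and two with a minus sign, so the growth cancels.
  set κ : ℝ := (Fintype.card σ : ℝ)⁻¹ with hκ
  have hmul : ∀ t, Fintype.card σ * Real.negMulLog (κ * t) =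
      Real.negMulLog t + t * (Fintype.card σ * Real.negMulLog κ) := by
    intro t
    rw [Real.negMulLog_mul]
    have : Fintype.card σ * κ = 1 := mul_inv_cancel₀ hσ
    linear_combination Real.negMulLog t * this
  have hsum : ∀ (t : γ → ℝ), ∑ s : γ × σ × δ, Real.negMulLog (κ * t s.1) =
      ∑ c, Real.negMulLog (t c) + (∑ c, t c) * (Fintype.card σ * Real.negMulLog κ) := by
    intro t
    simp [Fintype.sum_prod_type, hmul, Finset.sum_add_distrib, Finset.sum_mul]
  rw [classicalCondMutualInfo_eq, classicalCondMutualInfo_eq]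
  simp only [shannonEntropy]
  have e1 : ∑ s : β × γ × σ × δ, Real.negMulLog (∑ m, κ *
      ∑ a, if m = g s.2.2.1 a then q (a, s.1, s.2.1) else 0) =
      ∑ s : β × γ, Real.negMulLog (∑ a, q (a, s)) +
        (∑ s : β × γ, ∑ a, q (a, s)) * (Fintype.card σ * Real.negMulLog κ) := by
    have : ∀ s : β × γ × σ × δ,
        (∑ m, κ * ∑ a, if m = g s.2.2.1 a then q (a, s.1, s.2.1) else 0) =
        κ * ∑ a, q (a, s.1, s.2.1) := by
      intro s
      rw [← Finset.mul_sum, Finset.sum_comm]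
      simp
    simp only [this]
    rw [Fintype.sum_prod_type, Fintype.sum_prod_type, Fintype.sum_prod_type, Finset.sum_mul,
      ← Finset.sum_add_distrib]
    exact Finset.sum_congr rfl fun b _ => hsum fun c => ∑ a, q (a, b, c)
  have e2 : ∑ s : τ × γ × σ × δ, Real.negMulLog (∑ b, κ *
      ∑ a, if s.1 = g s.2.2.1 a then q (a, b, s.2.1) else 0) =
      ∑ s : α × γ, Real.negMulLog (∑ b, q (s.1, b, s.2)) +
        (∑ s : α × γ, ∑ b, q (s.1, b, s.2)) * (Fintype.card σ * Real.negMulLog κ) := by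
    have : ∀ s : τ × γ × σ × δ,
        (∑ b, κ * ∑ a, if s.1 = g s.2.2.1 a then q (a, b, s.2.1) else 0) =
        κ * ∑ a, if s.1 = g s.2.2.1 a then ∑ b, q (a, b, s.2.1) else 0 := by
      intro s
      rw [← Finset.mul_sum, Finset.sum_comm]
      congr 1
      refine Finset.sum_congr rfl fun a _ => ?_
      split_ifs <;> simp
    simp only [this]
    trans ∑ s : γ × σ × δ, ∑ a, Real.negMulLog (κ * ∑ b, q (a, b, s.1))
    · rw [Fintype.sum_prod_type_right]
      exact Finset.sum_congr rfl fun s _ =>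
        negMulLog_sum_ite_injective (hg s.2.1) (fun a => ∑ b, q (a, b, s.1)) κ
    · rw [Finset.sum_comm, Finset.sum_congr rfl fun a _ => hsum fun c => ∑ b, q (a, b, c),
        Finset.sum_add_distrib, ← Finset.sum_mul, Fintype.sum_prod_type, Fintype.sum_prod_type]
  have e3 : ∑ s : γ × σ × δ, Real.negMulLog (∑ m, ∑ b, κ *
      ∑ a, if m = g s.2.1 a then q (a, b, s.1) else 0) =
      ∑ c : γ, Real.negMulLog (∑ a, ∑ b, q (a, b, c)) +
        (∑ c : γ, ∑ a, ∑ b, q (a, b, c)) * (Fintype.card σ * Real.negMulLog κ) := by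
    have : ∀ s : γ × σ × δ,
        (∑ m, ∑ b, κ * ∑ a, if m = g s.2.1 a then q (a, b, s.1) else 0) =
        κ * ∑ a, ∑ b, q (a, b, s.1) := by
      intro s
      rw [Finset.sum_comm, Finset.sum_comm (s := Finset.univ (α := α)), Finset.mul_sum]
      refine Finset.sum_congr rfl fun b _ => ?_
      rw [← Finset.mul_sum, Finset.sum_comm]
      simp
    simp only [this]
    exact hsum fun c => ∑ a, ∑ b, q (a, b, c)
  have e4 : ∑ s : τ × β × γ × σ × δ, Real.negMulLog (κ *
      ∑ a, if s.1 = g s.2.2.2.1 a then q (a, s.2.1, s.2.2.1) else 0) =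
      ∑ s : α × β × γ, Real.negMulLog (q s) +
        (∑ s : α × β × γ, q s) * (Fintype.card σ * Real.negMulLog κ) := by
    trans ∑ s : β × γ × σ × δ, ∑ a, Real.negMulLog (κ * q (a, s.1, s.2.1))
    · rw [Fintype.sum_prod_type_right]
      exact Finset.sum_congr rfl fun s _ =>
        negMulLog_sum_ite_injective (hg s.2.2.1) (fun a => q (a, s.1, s.2.1)) κ
    · have h : ∀ a, ∑ s : β × γ × σ × δ, Real.negMulLog (κ * q (a, s.1, s.2.1)) =
          ∑ s : β × γ, Real.negMulLog (q (a, s)) +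
            (∑ s : β × γ, q (a, s)) * (Fintype.card σ * Real.negMulLog κ) := by
        intro a
        rw [Fintype.sum_prod_type, Fintype.sum_prod_type, Fintype.sum_prod_type, Finset.sum_mul,
          ← Finset.sum_add_distrib]
        exact Finset.sum_congr rfl fun b _ => hsum fun c => q (a, b, c)
      rw [Finset.sum_comm, Finset.sum_congr rfl fun a _ => h a, Finset.sum_add_distrib,
        ← Finset.sum_mul, Fintype.sum_prod_type (fun s => Real.negMulLog (q s)),
        Fintype.sum_prod_type q]
  rw [e1, e2, e3, e4]
  have t1 : ∑ s : β × γ, ∑ a, q (a, s) = ∑ s, q s := by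
    rw [Finset.sum_comm, Fintype.sum_prod_type]
  have t2 : ∑ s : α × γ, ∑ b, q (s.1, b, s.2) = ∑ s, q s := by
    simp only [Fintype.sum_prod_type]
    exact Finset.sum_congr rfl fun a _ => Finset.sum_comm
  have t3 : ∑ c, ∑ a, ∑ b, q (a, b, c) = ∑ s, q s := by
    simp only [Fintype.sum_prod_type]
    rw [Finset.sum_comm]
    exact Finset.sum_congr rfl fun a _ => Finset.sum_comm
  rw [t1, t2, t3]
  ring

end Entropy

/-! ### The Clifford algebra on words: generators, masks, dephasing -/

/-- The sign character of `ZMod 2`. -/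
noncomputable def sgn (s : ZMod 2) : ℂ := if s = 0 then 1 else -1

@[simp] theorem sgn_zero : sgn 0 = 1 := by simp [sgn]

@[simp] theorem sgn_one : sgn 1 = -1 := by simp [sgn]

theorem zmod_two_eq (s : ZMod 2) : s = 0 ∨ s = 1 := by
  revert s; decide

theorem sgn_add (s t : ZMod 2) : sgn (s + t) = sgn s * sgn t := by
  rcases zmod_two_eq s with rfl | rfl <;> rcases zmod_two_eq t with rfl | rfl <;>
    simp [CharTwo.add_self_eq_zero]

@[simp] theorem sgn_mul_self (s : ZMod 2) : sgn s * sgn s = 1 := by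
  rw [← sgn_add, CharTwo.add_self_eq_zero, sgn_zero]

@[simp] theorem star_sgn (s : ZMod 2) : star (sgn s) = sgn s := by
  rcases zmod_two_eq s with rfl | rfl <;> simp

/-- The labels of the computational basis of the message register. -/
abbrev Word (N : ℕ) : Type := Fin N → ZMod 2

section Word

variable {N : ℕ}

theorem Word.add_self (w : Word N) : w + w = 0 := by
  funext i; exact CharTwo.add_self_eq_zero _

theorem Word.add_add_cancel (u w : Word N) : u + (u + w) = w := by
  rw [← add_assoc, Word.add_self, zero_add]

theorem Word.eq_add_iff {u v w : Word N} : u = v + w ↔ w = v + u := by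
  constructor <;> (rintro rfl; rw [Word.add_add_cancel])

/-- The bilinear form that gives the signs of the Clifford multiplication. -/
def clif (u w : Word N) : ZMod 2 := ∑ i, ∑ j, if j < i then u i * w j else 0

theorem clif_add_left (u v w : Word N) : clif (u + v) w = clif u w + clif v w := by
  simp only [clif, ← Finset.sum_add_distrib]
  refine Finset.sum_congr rfl fun i _ => Finset.sum_congr rfl fun j _ => ?_
  split_ifs <;> simp [add_mul]

theorem clif_add_right (u v w : Word N) : clif u (v + w) = clif u v + clif u w := by
  simp only [clif, ← Finset.sum_add_distrib]
  refine Finset.sum_congr rfl fun i _ => Finset.sum_congr rfl fun j _ => ?_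
  split_ifs <;> simp [mul_add]

@[simp] theorem clif_zero_left (w : Word N) : clif 0 w = 0 := by simp [clif]

@[simp] theorem clif_zero_right (w : Word N) : clif w 0 = 0 := by simp [clif]

theorem clif_single (i j : Fin N) :
    clif (Pi.single i 1) (Pi.single j 1) = if j < i then 1 else 0 := by
  have h : ∀ a b : Fin N, (if b < a then (Pi.single i 1 : Word N) a * (Pi.single j 1 : Word N) b
      else 0) = if a = i then (if b = j then (if j < i then 1 else 0) else 0) else 0 := by
    intro a b
    by_cases ha : a = i <;> by_cases hb : b = j
    · subst ha hb; simp
    · simp [hb]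
    · simp [ha]
    · simp [hb]
  simp only [clif, h]
  simp

theorem sum_sgn_dotProduct (v : Word N) :
    ∑ q : Word N, sgn (q ⬝ᵥ v) = if v = 0 then 2 ^ N else 0 := by
  split_ifs with h
  · subst h
    simp
  · obtain ⟨i, hi⟩ := Function.ne_iff.mp h
    have hv : v i = 1 := (zmod_two_eq (v i)).resolve_left hi
    -- Flipping the coordinate `i`, where `v` is `1`, permutes the summands and negates each of
    -- them, so the sum equals its own negative.
    have h1 := Equiv.sum_comp (Equiv.addRight (Pi.single i 1 : Word N)) fun q => sgn (q ⬝ᵥ v)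
    simp only [Equiv.coe_addRight, add_dotProduct, single_dotProduct, hv, sgn_add,
      sgn_one, mul_neg, mul_one, Finset.sum_neg_distrib] at h1
    exact self_eq_neg.mp h1.symm

/-- The weighted translation `|w⟩ ↦ φ w • |u + w⟩`. -/
def shift (u : Word N) (φ : Word N → ℂ) : Matrix (Word N) (Word N) ℂ :=
  Matrix.of fun s t => if s = u + t then φ t else 0

theorem shift_apply (u : Word N) (φ : Word N → ℂ) (s t : Word N) :
    shift u φ s t = if s = u + t then φ t else 0 := rfl

theorem shift_mul (u v : Word N) (φ ψ : Word N → ℂ) :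
    shift u φ * shift v ψ = shift (u + v) fun w => φ (v + w) * ψ w := by
  ext s t
  simp only [Matrix.mul_apply, shift_apply, mul_ite, mul_zero, Finset.sum_ite_eq',
    Finset.mem_univ, if_true, ite_mul, zero_mul, add_assoc]

theorem shift_conjTranspose (u : Word N) (φ : Word N → ℂ) :
    (shift u φ)ᴴ = shift u fun w => star (φ (u + w)) := by
  ext s t
  simp only [Matrix.conjTranspose_apply, shift_apply]
  by_cases h : s = u + t
  · simp [h, Word.add_add_cancel]
  · have h' : ¬ t = u + s := fun e => h (Word.eq_add_iff.mp e)
    simp [h, h']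

theorem shift_zero_one : shift (0 : Word N) (fun _ => 1) = 1 := by
  ext s t
  simp [shift_apply, Matrix.one_apply]

theorem shift_smul (c : ℂ) (u : Word N) (φ : Word N → ℂ) :
    c • shift u φ = shift u fun w => c * φ w := by
  ext s t
  simp [shift_apply]

theorem shift_conjTranspose_mul_self {u : Word N} {φ : Word N → ℂ}
    (h : ∀ w, star (φ w) * φ w = 1) :
    (shift u φ)ᴴ * shift u φ = 1 := by
  rw [shift_conjTranspose, shift_mul, Word.add_self, ← shift_zero_one]
  congr 1
  funext w
  rw [Word.add_add_cancel, h]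

/-- Left multiplication by the `i`-th generator of the Clifford algebra. -/
noncomputable def gen (i : Fin N) : Matrix (Word N) (Word N) ℂ :=
  shift (Pi.single i 1) fun w => sgn (clif (Pi.single i 1) w)

/-- Right multiplication by the basis element `a` of the Clifford algebra. -/
noncomputable def mask (a : Word N) : Matrix (Word N) (Word N) ℂ :=
  shift a fun w => sgn (clif w a)

/-- The diagonal sign matrix that dephases when averaged over `a`. -/
noncomputable def dephase (a : Word N) : Matrix (Word N) (Word N) ℂ :=
  shift 0 fun w => sgn (a ⬝ᵥ w)

theorem gen_mul_self (i : Fin N) : gen i * gen i = 1 := by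
  rw [gen, shift_mul, Word.add_self, ← shift_zero_one]
  congr 1
  funext w
  rw [clif_add_right, sgn_add, mul_assoc, sgn_mul_self, clif_single]
  simp

theorem gen_conjTranspose (i : Fin N) : (gen i)ᴴ = gen i := by
  rw [gen, shift_conjTranspose]
  congr 1
  funext w
  rw [star_sgn, clif_add_right, clif_single]
  simp

theorem gen_anticomm {i j : Fin N} (h : i ≠ j) : gen i * gen j = -(gen j * gen i) := by
  rw [gen, gen, shift_mul, shift_mul, ← neg_one_smul ℂ, shift_smul, add_comm]
  congr 1
  funext w
  rw [clif_add_right, clif_add_right, sgn_add, sgn_add, clif_single, clif_single]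
  rcases lt_or_gt_of_ne h with h | h <;> simp [h, h.not_gt] <;> ring

/-- Left and right multiplications commute because the algebra is associative; on the level of signs
this is the bilinearity of `clif`. -/
theorem gen_mul_mask (i : Fin N) (a : Word N) : gen i * mask a = mask a * gen i := by
  rw [gen, mask, shift_mul, shift_mul, add_comm]
  congr 1
  funext w
  rw [clif_add_right, clif_add_left, sgn_add, sgn_add]
  ring

theorem mask_isometry (a : Word N) : (mask a)ᴴ * mask a = 1 :=
  shift_conjTranspose_mul_self fun w => by simp

theorem mask_mul_conjTranspose (a : Word N) : mask a * (mask a)ᴴ = 1 :=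
  mul_eq_one_comm.mp (mask_isometry a)

theorem dephase_isometry (a : Word N) : (dephase a)ᴴ * dephase a = 1 :=
  shift_conjTranspose_mul_self fun w => by simp

theorem mask_apply_zero (a s : Word N) : mask a s 0 = if s = a then 1 else 0 := by
  simp [mask, shift_apply]

theorem mask_mul_mask_apply_zero (a b s : Word N) :
    (mask b * mask a) s 0 = if s = b + a then sgn (clif a b) else 0 := by
  rw [mask, mask, shift_mul, shift_apply]
  simp

/-- Basis elements of the Clifford algebra commute up to a sign. The sign is the same for all words,
so removing Alice's mask from under Bob's leaves only a global phase. -/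
theorem mask_conj_mask (a b : Word N) :
    (mask a)ᴴ * (mask b * mask a) = sgn (clif a b + clif b a) • mask b := by
  have h : mask b * mask a = sgn (clif a b + clif b a) • (mask a * mask b) := by
    rw [mask, mask, shift_mul, shift_mul, shift_smul, add_comm]
    congr 1
    funext w
    simp only [clif_add_left, sgn_add]
    linear_combination (- sgn (clif a b) * sgn (clif w a) * sgn (clif w b)) *
      sgn_mul_self (clif b a)
  rw [h, Matrix.mul_smul, ← Matrix.mul_assoc, mask_isometry, Matrix.one_mul]

theorem mask_mul_apply (b : Word N) (A : Matrix (Word N) (Word N) ℂ) (s t : Word N) :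
    (mask b * A) s t = sgn (clif (b + s) b) * A (b + s) t := by
  rw [Matrix.mul_apply, Finset.sum_eq_single (b + s)]
  · rw [mask, shift_apply, if_pos (Word.add_add_cancel b s).symm]
  · intro w _ hw
    rw [mask, shift_apply, if_neg (fun h => hw (Word.eq_add_iff.mp h)), zero_mul]
  · simp

theorem dephase_mul_apply (a : Word N) (A : Matrix (Word N) (Word N) ℂ) (s t : Word N) :
    (dephase a * A) s t = sgn (a ⬝ᵥ s) * A s t := by
  rw [Matrix.mul_apply, Finset.sum_eq_single s]
  · simp [dephase, shift_apply]
  · intro w _ hw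
    simp [dephase, shift_apply, hw.symm]
  · simp

theorem mask_conjTranspose_mul_apply (b : Word N) (A : Matrix (Word N) (Word N) ℂ)
    (s t : Word N) : ((mask b)ᴴ * A) s t = sgn (clif s b) * A (b + s) t := by
  rw [mask, shift_conjTranspose, Matrix.mul_apply, Finset.sum_eq_single (b + s)]
  · rw [shift_apply, if_pos (Word.add_add_cancel b s).symm, Word.add_add_cancel, star_sgn]
  · intro w _ hw
    rw [shift_apply, if_neg (fun h => hw (Word.eq_add_iff.mp h)), zero_mul]
  · simp

/-- A real combination of Clifford generators with unit coefficient vector squares to `1`. -/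
theorem sum_gen_mul_self {ι : Type*} [Fintype ι] {g : ι → Fin N} (hg : Function.Injective g)
    (c : ι → ℝ) (hc : ∑ z, c z ^ 2 = 1) :
    (∑ z, (c z : ℂ) • gen (g z)) * ∑ z, (c z : ℂ) • gen (g z) = 1 := by
  classical
  set S := (∑ z, (c z : ℂ) • gen (g z)) * ∑ z, (c z : ℂ) • gen (g z) with hS
  have h1 : S = ∑ z, ∑ w, ((c z * c w : ℝ) : ℂ) • (gen (g z) * gen (g w)) := by
    rw [hS, Finset.sum_mul_sum]
    refine Finset.sum_congr rfl fun z _ => Finset.sum_congr rfl fun w _ => ?_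
    rw [Matrix.smul_mul, Matrix.mul_smul, smul_smul]
    push_cast
    rfl
  have h2 : S = ∑ z, ∑ w, ((c z * c w : ℝ) : ℂ) • (gen (g w) * gen (g z)) := by
    rw [h1, Finset.sum_comm]
    refine Finset.sum_congr rfl fun z _ => Finset.sum_congr rfl fun w _ => ?_
    rw [mul_comm (c w)]
  -- Adding the double sum to its copy with the factors swapped leaves only anticommutators, which
  -- vanish off the diagonal.
  have h3 : S + S = 1 + 1 := by
    nth_rewrite 1 [h1]
    rw [h2, ← Finset.sum_add_distrib]
    have : ∀ z, (∑ w, ((c z * c w : ℝ) : ℂ) • (gen (g z) * gen (g w))) +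
        (∑ w, ((c z * c w : ℝ) : ℂ) • (gen (g w) * gen (g z))) =
        ((c z ^ 2 : ℝ) : ℂ) • (1 + 1 : Matrix (Word N) (Word N) ℂ) := by
      intro z
      rw [← Finset.sum_add_distrib, Finset.sum_eq_single z]
      · rw [gen_mul_self, ← smul_add, sq]
      · intro w _ hw
        rw [gen_anticomm (hg.ne hw)]
        simp
      · simp
    rw [Finset.sum_congr rfl fun z _ => this z, ← Finset.sum_smul, ← Complex.ofReal_sum, hc]
    simp
  rw [← two_smul ℂ S, ← two_smul ℂ (1 : Matrix (Word N) (Word N) ℂ)] at h3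
  exact smul_right_injective _ (two_ne_zero' ℂ) h3

end Word

/-! ### Rotors and their commutator with the distinguished generator -/

section Rotor

variable {N : ℕ} {ι : Type*} [Fintype ι]

/-- The vector of the Clifford algebra with real coefficients `c` on the generators `g z`. -/
noncomputable def cliffordVector (g : ι → Fin N) (c : ι → ℝ) : Matrix (Word N) (Word N) ℂ :=
  ∑ z, (c z : ℂ) • gen (g z)

/-- The rotor by a quarter turn in the plane of the vector `c` and the generator `f`: a square root
of the product of the two. -/
noncomputable def rotor (f : Fin N) (g : ι → Fin N) (c : ι → ℝ) : Matrix (Word N) (Word N) ℂ :=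
  ((√2 : ℝ)⁻¹ : ℂ) • (1 + cliffordVector g c * gen f)

variable {f : Fin N} {g : ι → Fin N} {c : ι → ℝ}

theorem cliffordVector_conjTranspose : (cliffordVector g c)ᴴ = cliffordVector g c := by
  simp [cliffordVector, Matrix.conjTranspose_sum, gen_conjTranspose]

theorem gen_mul_cliffordVector (hf : ∀ z, f ≠ g z) :
    gen f * cliffordVector g c = -(cliffordVector g c * gen f) := by
  simp only [cliffordVector, Finset.mul_sum, Finset.sum_mul, ← Finset.sum_neg_distrib]
  refine Finset.sum_congr rfl fun z _ => ?_
  rw [Matrix.mul_smul, Matrix.smul_mul, gen_anticomm (hf z), smul_neg]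

theorem cliffordVector_mul_mask (a : Word N) :
    cliffordVector g c * mask a = mask a * cliffordVector g c := by
  simp only [cliffordVector, Finset.mul_sum, Finset.sum_mul]
  refine Finset.sum_congr rfl fun z _ => ?_
  rw [Matrix.mul_smul, Matrix.smul_mul, gen_mul_mask]

theorem rotor_mul_mask (a : Word N) : rotor f g c * mask a = mask a * rotor f g c := by
  rw [rotor, Matrix.smul_mul, Matrix.mul_smul, Matrix.add_mul, Matrix.mul_add, Matrix.mul_assoc,
    gen_mul_mask, ← Matrix.mul_assoc, cliffordVector_mul_mask, Matrix.mul_assoc, Matrix.one_mul,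
    Matrix.mul_one]

theorem rotor_conjTranspose :
    (rotor f g c)ᴴ = ((√2 : ℝ)⁻¹ : ℂ) • (1 + gen f * cliffordVector g c) := by
  rw [rotor, Matrix.conjTranspose_smul, Matrix.conjTranspose_add, Matrix.conjTranspose_mul,
    gen_conjTranspose, cliffordVector_conjTranspose]
  simp

theorem rotor_conjTranspose_mul_mask (a : Word N) :
    (rotor f g c)ᴴ * mask a = mask a * (rotor f g c)ᴴ := by
  rw [rotor_conjTranspose, Matrix.smul_mul, Matrix.mul_smul, Matrix.add_mul, Matrix.mul_add,
    Matrix.mul_assoc, cliffordVector_mul_mask, ← Matrix.mul_assoc, gen_mul_mask, Matrix.mul_assoc,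
    Matrix.one_mul, Matrix.mul_one]

theorem inv_sqrt_two_mul_self : ((√2 : ℝ)⁻¹ : ℂ) * ((√2 : ℝ)⁻¹ : ℂ) = 2⁻¹ := by
  rw [← mul_inv, ← Complex.ofReal_mul, Real.mul_self_sqrt (by norm_num)]
  norm_num

theorem rotor_isometry (hf : ∀ z, f ≠ g z) (hg : Function.Injective g) (hc : ∑ z, c z ^ 2 = 1) :
    (rotor f g c)ᴴ * rotor f g c = 1 := by
  have h : (1 + gen f * cliffordVector g c) * (1 + cliffordVector g c * gen f) =
      (2 : ℂ) • 1 := by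
    have h1 : gen f * cliffordVector g c * (cliffordVector g c * gen f) = 1 := by
      rw [Matrix.mul_assoc, ← Matrix.mul_assoc (cliffordVector g c), cliffordVector,
        sum_gen_mul_self hg c hc, Matrix.one_mul, gen_mul_self]
    rw [Matrix.add_mul, Matrix.mul_add, Matrix.mul_add, h1, gen_mul_cliffordVector hf, two_smul]
    simp
  rw [rotor_conjTranspose, rotor, Matrix.smul_mul, Matrix.mul_smul, smul_smul,
    inv_sqrt_two_mul_self, h, smul_smul, inv_mul_cancel₀ two_ne_zero, one_smul]

/-- Conjugation by `gen f` swaps the two factors of `cliffordVector g c * gen f`, and so does the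
adjoint. -/
theorem gen_conj_rotor : gen f * (rotor f g c * gen f) = (rotor f g c)ᴴ := by
  rw [rotor_conjTranspose, rotor, Matrix.smul_mul, Matrix.mul_smul, Matrix.add_mul, Matrix.mul_add,
    Matrix.one_mul, gen_mul_self, Matrix.mul_assoc (cliffordVector g c), gen_mul_self,
    Matrix.mul_one]

/-- The bivector `gen f * cliffordVector g c` squares to `-1`, hence behaves like the imaginary
unit: `(1 + i)/√2` is a square root of `i`. -/
theorem rotor_conjTranspose_mul_self (hf : ∀ z, f ≠ g z) (hg : Function.Injective g)
    (hc : ∑ z, c z ^ 2 = 1) :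
    (rotor f g c)ᴴ * (rotor f g c)ᴴ = gen f * cliffordVector g c := by
  have h1 : gen f * cliffordVector g c * (gen f * cliffordVector g c) = -1 := by
    nth_rewrite 1 [gen_mul_cliffordVector hf]
    rw [Matrix.neg_mul, Matrix.mul_assoc, ← Matrix.mul_assoc (gen f), gen_mul_self,
      Matrix.one_mul, cliffordVector, sum_gen_mul_self hg c hc]
  have h : (1 + gen f * cliffordVector g c) * (1 + gen f * cliffordVector g c) =
      (2 : ℂ) • (gen f * cliffordVector g c) := by
    rw [Matrix.add_mul, Matrix.mul_add, Matrix.mul_add, h1, two_smul, Matrix.one_mul,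
      Matrix.one_mul, Matrix.mul_one]
    abel
  rw [rotor_conjTranspose, Matrix.smul_mul, Matrix.mul_smul, smul_smul,
    inv_sqrt_two_mul_self, h, smul_smul, inv_mul_cancel₀ two_ne_zero, one_smul]

/-- The group commutator of the rotor and the generator `f`. -/
theorem rotor_commutator (hf : ∀ z, f ≠ g z) (hg : Function.Injective g)
    (hc : ∑ z, c z ^ 2 = 1) :
    gen f * (rotor f g c * (gen f * (rotor f g c)ᴴ)) = gen f * cliffordVector g c := by
  rw [← rotor_conjTranspose_mul_self hf hg hc, ← Matrix.mul_assoc (rotor f g c),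
    ← Matrix.mul_assoc (gen f), gen_conj_rotor]

theorem gen_mul_cliffordVector_apply_zero (f : Fin N) (g : ι → Fin N) (c : ι → ℝ) (s : Word N) :
    (gen f * cliffordVector g c) s 0 =
      ∑ z, if s = Pi.single f 1 + Pi.single (g z) 1 then
        (c z : ℂ) * sgn (if g z < f then 1 else 0) else 0 := by
  simp only [cliffordVector, Finset.mul_sum, Matrix.sum_apply, Matrix.mul_smul, Matrix.smul_apply]
  refine Finset.sum_congr rfl fun z _ => ?_
  rw [gen, gen, shift_mul, shift_apply]
  simp [clif_single]

/-- Different `z` lead to different words, so there is no interference and the reordering signs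
disappear in the modulus. -/
theorem normSq_gen_mul_cliffordVector_apply_zero (f : Fin N) (hg : Function.Injective g)
    (s : Word N) :
    Complex.normSq ((gen f * cliffordVector g c) s 0) =
      ∑ z, if s = Pi.single f 1 + Pi.single (g z) 1 then c z ^ 2 else 0 := by
  rw [gen_mul_cliffordVector_apply_zero]
  have hinj : Function.Injective fun z => (Pi.single f 1 + Pi.single (g z) 1 : Word N) := by
    intro z w h
    have h' := congrFun (add_left_cancel h) (g z)
    by_contra hne
    simp [hg.ne hne] at h'
  by_cases hs : ∃ z, s = Pi.single f 1 + Pi.single (g z) 1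
  · obtain ⟨z, rfl⟩ := hs
    classical
    simp only [hinj.eq_iff, Finset.sum_ite_eq, Finset.mem_univ, if_true, Complex.normSq_mul,
      Complex.normSq_ofReal]
    split_ifs <;> simp [sq]
  · have : ∀ z, ¬ s = Pi.single f 1 + Pi.single (g z) 1 := fun z h => hs ⟨z, h⟩
    simp [this]

end Rotor

/-! ### Alternating products and moving masks through them -/

section Run

variable {κ : Type*} [Fintype κ] [DecidableEq κ]

/-- The product of the alternating sequence of operations `a 0, b 0, a 1, b 1, …`. -/
def run (a b : ℕ → Matrix κ κ ℂ) : ℕ → Matrix κ κ ℂ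
  | 0 => 1
  | j + 1 => b j * (a j * run a b j)

variable {a b : ℕ → Matrix κ κ ℂ}

theorem run_isometry (ha : ∀ j, (a j)ᴴ * a j = 1) (hb : ∀ j, (b j)ᴴ * b j = 1) (j : ℕ) :
    (run a b j)ᴴ * run a b j = 1 := by
  induction j with
  | zero => simp [run]
  | succ j ih =>
    rw [run, Matrix.conjTranspose_mul, Matrix.mul_assoc, ← Matrix.mul_assoc (b j)ᴴ, hb,
      Matrix.one_mul, Matrix.conjTranspose_mul, Matrix.mul_assoc, ← Matrix.mul_assoc (a j)ᴴ, ha,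
      Matrix.one_mul, ih]

theorem run_commute {m : Matrix κ κ ℂ} (ha : ∀ j, a j * m = m * a j) (hb : ∀ j, b j * m = m * b j)
    (j : ℕ) : run a b j * m = m * run a b j := by
  induction j with
  | zero => simp [run]
  | succ j ih =>
    rw [run, Matrix.mul_assoc, Matrix.mul_assoc, ih, ← Matrix.mul_assoc (a j), ha,
      Matrix.mul_assoc, ← Matrix.mul_assoc (b j), hb, Matrix.mul_assoc]

/-- Masks `p` and `q` that are applied at the first turns can be moved to the front. -/
theorem run_masked {p q : Matrix κ κ ℂ} (haq : ∀ j, a j * q = q * a j)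
    {a' b' : ℕ → Matrix κ κ ℂ} {n : ℕ}
    (ha' : ∀ j < n, a' j = a j * if j = 0 then p else 1)
    (hb' : ∀ j < n, b' j = b j * if j = 0 then q else 1) {j : ℕ} (hj : j ≤ n) :
    run a' b' j = run a b j * if j = 0 then 1 else q * p := by
  induction j with
  | zero => simp [run]
  | succ j ih =>
    rw [run, run, ha' j hj, hb' j hj, ih (Nat.le_of_succ_le hj)]
    rcases Nat.eq_zero_or_pos j with rfl | h
    -- Bob's mask sits between `b 0` and `a 0`; it only has to pass `a 0` to stand next to Alice's.
    · simp only [run, if_true, Matrix.mul_one, if_false, zero_add, one_ne_zero]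
      rw [Matrix.mul_assoc, ← Matrix.mul_assoc q, ← haq, Matrix.mul_assoc, Matrix.mul_assoc]
    · simp only [h.ne', if_false, Matrix.mul_one, Nat.succ_ne_zero, Matrix.mul_assoc]

end Run

/-! ### Selecting the rotor that belongs to Bob's input -/

section Selection

variable {N : ℕ} {X Y Z : Type*} [Fintype Z]

/-- Alice's operations: a rotor and its inverse for the outcome amplitudes of each `w t`. -/
noncomputable def aliceRotor (f : Fin N) (g : Z → Fin N) (c : X → Y → Z → ℝ) (w : ℕ → Y) (j : ℕ)
    (x : X) : Matrix (Word N) (Word N) ℂ :=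
  if Even j then (rotor f g (c x (w (j / 2))))ᴴ else rotor f g (c x (w (j / 2)))

/-- Bob's operations: the generator `f` at the turns that belong to his input. -/
noncomputable def bobGen (f : Fin N) (idx : Y → ℕ) (j : ℕ) (y : Y) : Matrix (Word N) (Word N) ℂ :=
  if idx y = j / 2 then gen f else 1

variable {f : Fin N} {g : Z → Fin N} {c : X → Y → Z → ℝ} {w : ℕ → Y} {idx : Y → ℕ}

theorem aliceRotor_isometry (hf : ∀ z, f ≠ g z) (hg : Function.Injective g)
    (hc : ∀ x y, ∑ z, c x y z ^ 2 = 1) (j : ℕ) (x : X) :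
    (aliceRotor f g c w j x)ᴴ * aliceRotor f g c w j x = 1 := by
  have h := rotor_isometry hf hg (hc x (w (j / 2)))
  unfold aliceRotor
  split_ifs
  · rw [Matrix.conjTranspose_conjTranspose]
    exact mul_eq_one_comm.mp h
  · exact h

theorem aliceRotor_mul_mask (j : ℕ) (x : X) (a : Word N) :
    aliceRotor f g c w j x * mask a = mask a * aliceRotor f g c w j x := by
  unfold aliceRotor
  split_ifs
  · exact rotor_conjTranspose_mul_mask a
  · exact rotor_mul_mask a

theorem bobGen_isometry (j : ℕ) (y : Y) : (bobGen f idx j y)ᴴ * bobGen f idx j y = 1 := by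
  unfold bobGen
  split_ifs
  · rw [gen_conjTranspose, gen_mul_self]
  · simp

theorem bobGen_mul_mask (j : ℕ) (y : Y) (a : Word N) :
    bobGen f idx j y * mask a = mask a * bobGen f idx j y := by
  unfold bobGen
  split_ifs
  · exact gen_mul_mask f a
  · simp

theorem run_aliceRotor_bobGen (hf : ∀ z, f ≠ g z) (hg : Function.Injective g)
    (hc : ∀ x y, ∑ z, c x y z ^ 2 = 1) (hw : ∀ y, w (idx y) = y) (x : X) (y : Y) (t : ℕ) :
    run (fun j => aliceRotor f g c w j x) (fun j => bobGen f idx j y) (2 * t) =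
      if idx y < t then gen f * cliffordVector g (c x y) else 1 := by
  induction t with
  | zero => simp [run]
  | succ t ih =>
    rw [show 2 * (t + 1) = 2 * t + 1 + 1 by ring, run, run, ih]
    have h1 : (2 * t + 1) / 2 = t := by omega
    have h2 : 2 * t / 2 = t := by omega
    have h3 : ¬ Even (2 * t + 1) := by simp
    have h4 : Even (2 * t) := even_two_mul t
    simp only [aliceRotor, bobGen, h1, h2, if_neg h3, if_pos h4]
    -- The turns `2 * t` and `2 * t + 1` both treat the input `w t`. If it is Bob's, the run so far
    -- is `1` and these turns contribute the commutator; if not, the rotor cancels its inverse.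
    by_cases h : idx y = t
    · subst h
      rw [if_pos rfl, if_neg (lt_irrefl _), if_pos (Nat.lt_succ_self _), hw, Matrix.mul_one]
      exact rotor_commutator hf hg (hc x y)
    · rw [if_neg h, Matrix.one_mul, Matrix.one_mul, ← Matrix.mul_assoc,
        mul_eq_one_comm.mp (rotor_isometry hf hg (hc x (w t))), Matrix.one_mul]
      congr 1
      exact propext ⟨fun h' => by omega, fun h' => by omega⟩

end Selection

/-! ### Cost terms of protocols with diagonal reduced states -/

namespace Protocol

variable {X Y Z : Type*} [Fintype Z]

/-- The global state is block diagonal in the classical registers, so only the blocks need to become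
diagonal once Alice's coins and memory are traced out. The factor `2 ^ Q.cA` in `h` appears because
the sum over her coins is not averaged. -/
theorem oddTerm_eq_of_diagonal [Fintype X] [DecidableEq X] [Fintype Y] [DecidableEq Y]
    (Q : Protocol X Y Z) (μ : X × Y → ℝ) (j : ℕ)
    (p : X → Y → Q.RB → Q.M (2 * j + 1) → Q.B j → ℝ)
    (h : ∀ x y rB m b m' b', ∑ rA, ∑ a, Q.oddState x y rA rB j (a, m, b) *
      star (Q.oddState x y rA rB j (a, m', b')) =
        if m = m' ∧ b = b' then ((2 ^ Q.cA * p x y rB m b : ℝ) : ℂ) else 0) :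
    Q.oddTerm μ j = classicalCondMutualInfo
      fun s : Q.M (2 * j + 1) × X × (Y × Q.RB × Q.B j) =>
        μ (s.2.1, s.2.2.1) / 2 ^ Q.cB * p s.2.1 s.2.2.1 s.2.2.2.1 s.1 s.2.2.2.2 := by
  unfold oddTerm
  rw [← condMutualInfo_diagonal]
  refine congrArg condMutualInfo ?_
  ext ⟨m, x, y, rB, b⟩ ⟨m', x', y', rB', b'⟩
  simp only [traceRight, oddRho, cqState, weight, Matrix.of_apply, Matrix.submatrix_apply,
    Matrix.diagonal_apply, Prod.mk.injEq, Fintype.sum_prod_type]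
  by_cases hc : x = x' ∧ y = y' ∧ rB = rB'
  · obtain ⟨rfl, rfl, rfl⟩ := hc
    simp only [true_and, and_true, if_true, ← Finset.mul_sum, h]
    split_ifs
    · push_cast
      field_simp
    · simp
  · rw [if_neg (by tauto)]
    refine Finset.sum_eq_zero fun rA _ => Finset.sum_eq_zero fun a _ => if_neg (by tauto)

theorem evenTerm_eq_of_diagonal [Fintype X] [DecidableEq X] [Fintype Y] [DecidableEq Y]
    (Q : Protocol X Y Z) (μ : X × Y → ℝ) (j : ℕ)
    (p : X → Y → Q.RA → Q.M (2 * j) → Q.A j → ℝ)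
    (h : ∀ x y rA m a m' a', ∑ rB, ∑ b, Q.evenState x y rA rB j (a, m, b) *
      star (Q.evenState x y rA rB j (a', m', b)) =
        if m = m' ∧ a = a' then ((2 ^ Q.cB * p x y rA m a : ℝ) : ℂ) else 0) :
    Q.evenTerm μ j = classicalCondMutualInfo
      fun s : Q.M (2 * j) × Y × (X × Q.RA × Q.A j) =>
        μ (s.2.2.1, s.2.1) / 2 ^ Q.cA * p s.2.2.1 s.2.1 s.2.2.2.1 s.1 s.2.2.2.2 := by
  unfold evenTerm
  rw [← condMutualInfo_diagonal]
  refine congrArg condMutualInfo ?_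
  ext ⟨m, y, x, rA, a⟩ ⟨m', y', x', rA', a'⟩
  simp only [traceRight, evenRho, cqState, weight, Matrix.of_apply, Matrix.submatrix_apply,
    Matrix.diagonal_apply, Prod.mk.injEq, Fintype.sum_prod_type]
  by_cases hc : x = x' ∧ y = y' ∧ rA = rA'
  · obtain ⟨rfl, rfl, rfl⟩ := hc
    simp only [true_and, and_true, if_true, ← Finset.mul_sum, h]
    split_ifs
    · push_cast
      field_simp
    · simp
  · rw [if_neg (by tauto)]
    refine Finset.sum_eq_zero fun rB _ => Finset.sum_eq_zero fun b _ => if_neg (by tauto)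

end Protocol

/-! ### Output probabilities form a stochastic kernel -/

/-- The squared norm of a vector. -/
def sqNorm {α : Type*} [Fintype α] (ψ : α → ℂ) : ℂ := star ψ ⬝ᵥ ψ

theorem sqNorm_mulVec {α β : Type*} [Fintype α] [Fintype β] [DecidableEq β] {V : Matrix α β ℂ}
    (hV : Vᴴ * V = 1) (ψ : β → ℂ) : sqNorm (V *ᵥ ψ) = sqNorm ψ := by
  rw [sqNorm, Matrix.star_mulVec, ← Matrix.dotProduct_mulVec, Matrix.mulVec_mulVec, hV,
    Matrix.one_mulVec, sqNorm]

theorem sqNorm_eq_sum_right {α μ β : Type*} [Fintype α] [Fintype μ] [Fintype β]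
    (ψ : α × μ × β → ℂ) : sqNorm ψ = ∑ b, sqNorm fun p : α × μ => ψ (p.1, p.2, b) := by
  simp only [sqNorm, dotProduct, Fintype.sum_prod_type, Pi.star_apply]
  exact (Finset.sum_congr rfl fun a _ => Finset.sum_comm).trans Finset.sum_comm

theorem sqNorm_applyAlice {α α' μ μ' β : Type*} [Fintype α] [DecidableEq α] [Fintype μ]
    [DecidableEq μ] [Fintype α'] [Fintype μ'] [Fintype β] {V : Matrix (α' × μ') (α × μ) ℂ}
    (hV : Vᴴ * V = 1) (ψ : α × μ × β → ℂ) : sqNorm (applyAlice V ψ) = sqNorm ψ := by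
  rw [sqNorm_eq_sum_right, sqNorm_eq_sum_right]
  exact Finset.sum_congr rfl fun b _ => sqNorm_mulVec hV fun p : α × μ => ψ (p.1, p.2, b)

theorem sqNorm_applyBob {α μ μ' β β' : Type*} [Fintype α] [Fintype μ] [DecidableEq μ]
    [Fintype β] [DecidableEq β] [Fintype μ'] [Fintype β'] {V : Matrix (μ' × β') (μ × β) ℂ}
    (hV : Vᴴ * V = 1) (ψ : α × μ × β → ℂ) : sqNorm (applyBob V ψ) = sqNorm ψ := by
  have h : ∀ a, sqNorm (fun p : μ' × β' => applyBob V ψ (a, p)) =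
      sqNorm fun p : μ × β => ψ (a, p) := fun a =>
    sqNorm_mulVec hV fun p : μ × β => ψ (a, p)
  simp only [sqNorm, dotProduct, Pi.star_apply] at h ⊢
  rw [Fintype.sum_prod_type, Fintype.sum_prod_type]
  exact Finset.sum_congr rfl fun a _ => h a

namespace Protocol

variable {X Y Z : Type*} [Fintype Z]

theorem sqNorm_evenState (Q : Protocol X Y Z) (x : X) (y : Y) (rA : Q.RA) (rB : Q.RB) (j : ℕ) :
    sqNorm (Q.evenState x y rA rB j) = 1 := by
  induction j with
  | zero => simp [evenState, sqNorm]
  | succ j ih =>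
    rw [evenState, sqNorm_applyBob (Q.UB_isometry j y rB),
      sqNorm_applyAlice (Q.UA_isometry j x rA), ih]

theorem sqNorm_finalState (Q : Protocol X Y Z) (x : X) (y : Y) (rA : Q.RA) (rB : Q.RB) :
    sqNorm (Q.finalState x y rA rB) = 1 := by
  rw [finalState, sqNorm_applyBob (Q.UF_isometry y rB), oddState,
    sqNorm_applyAlice (Q.UA_isometry _ x rA), sqNorm_evenState]

theorem outProb_nonneg (Q : Protocol X Y Z) (x : X) (y : Y) (z : Z) : 0 ≤ Q.outProb x y z := by
  unfold outProb
  refine div_nonneg ?_ (by positivity)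
  refine Finset.sum_nonneg fun rA _ => Finset.sum_nonneg fun rB _ => Finset.sum_nonneg fun a _ =>
    Finset.sum_nonneg fun g _ => ?_
  exact (Q.E_posSemidef z).re_dotProduct_nonneg _

/-- Isometries keep the final state at norm one and the POVM elements sum to `1`, so every pair of
coin strings contributes exactly `1` before averaging. -/
theorem sum_outProb (Q : Protocol X Y Z) (x : X) (y : Y) : ∑ z, Q.outProb x y z = 1 := by
  have h : ∀ rA rB, ∑ a : Q.A (Q.n + 1), ∑ g : Q.G, ∑ z,
      (star (fun o => Q.finalState x y rA rB (a, g, o)) ⬝ᵥ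
        (Q.E z *ᵥ fun o => Q.finalState x y rA rB (a, g, o))).re = 1 := by
    intro rA rB
    have h1 := congrArg Complex.re (Q.sqNorm_finalState x y rA rB)
    rw [Complex.one_re, sqNorm, dotProduct, Complex.re_sum, Fintype.sum_prod_type] at h1
    rw [← h1]
    refine Finset.sum_congr rfl fun a _ => ?_
    rw [Fintype.sum_prod_type]
    refine Finset.sum_congr rfl fun g _ => ?_
    rw [← Complex.re_sum, ← dotProduct_sum, ← Matrix.sum_mulVec, Q.E_sum, Matrix.one_mulVec,
      dotProduct, Complex.re_sum]
    rfl
  unfold outProb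
  rw [← Finset.sum_div, Finset.sum_comm]
  have h2 : ∀ rA : Q.RA, ∑ z, ∑ rB : Q.RB, ∑ a : Q.A (Q.n + 1), ∑ g : Q.G,
      (star (fun o => Q.finalState x y rA rB (a, g, o)) ⬝ᵥ
        (Q.E z *ᵥ fun o => Q.finalState x y rA rB (a, g, o))).re = 2 ^ Q.cB := by
    intro rA
    rw [Finset.sum_comm]
    have h3 : ∀ rB : Q.RB, ∑ z, ∑ a : Q.A (Q.n + 1), ∑ g : Q.G,
      (star (fun o => Q.finalState x y rA rB (a, g, o)) ⬝ᵥ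
        (Q.E z *ᵥ fun o => Q.finalState x y rA rB (a, g, o))).re = 1 := by
      intro rB
      rw [Finset.sum_comm, ← h rA rB]
      exact Finset.sum_congr rfl fun a _ => Finset.sum_comm
    simp [h3]
  simp [h2]

end Protocol

/-! ### Averaging over coins -/

section Coins

variable {N : ℕ}

/-- Coin flips as words. -/
def bits : (Fin N → Bool) ≃ Word N :=
  Equiv.piCongrRight fun _ => (finTwoEquiv.symm : Bool ≃ Fin 2)

theorem card_coins : Fintype.card (Fin N → Bool) = 2 ^ N := by simp

theorem card_word : Fintype.card (Word N) = 2 ^ N := by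
  rw [← Fintype.card_congr (bits (N := N)), card_coins]

/-- Averaging over a family of masks that permutes the basis states leads to the uniform mixture. -/
theorem sum_mask_average {κ : Type*} [Fintype κ] {U : Matrix (Word N) (Word N) ℂ}
    (hU : Uᴴ * U = 1) {Q : κ → Matrix (Word N) (Word N) ℂ} {ε : κ → ℂ} (σ : κ ≃ Word N)
    (hε : ∀ r, ε r * star (ε r) = 1) (hQ : ∀ r s, Q r s 0 = if s = σ r then ε r else 0)
    (m m' : Word N) :
    ∑ r, (U * Q r) m 0 * star ((U * Q r) m' 0) = if m = m' then 1 else 0 := by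
  have h : ∀ r m, (U * Q r) m 0 = U m (σ r) * ε r := by
    intro r m
    simp [Matrix.mul_apply, hQ]
  have h1 : ∀ r, (U * Q r) m 0 * star ((U * Q r) m' 0) = U m (σ r) * star (U m' (σ r)) := by
    intro r
    rw [h, h, star_mul]
    linear_combination (U m (σ r) * star (U m' (σ r))) * hε r
  simp only [h1]
  -- The phases have cancelled and `σ r` runs through the whole basis, so the sum is an entry of `U
  -- * Uᴴ`, which is `1` because `U` is square.
  rw [Equiv.sum_comp σ fun s => U m s * star (U m' s)]
  have h2 := Matrix.ext_iff.mpr (mul_eq_one_comm.mp hU) m m'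
  rw [Matrix.one_apply, Matrix.mul_apply] at h2
  exact h2

end Coins

section Isometry

theorem submatrix_isometry {κ μ ν : Type*} [Fintype κ] [Fintype μ] [Fintype ν]
    [DecidableEq κ] [DecidableEq ν] {A : Matrix κ κ ℂ} (h : Aᴴ * A = 1) (e : μ ≃ κ) (f : ν ≃ κ) :
    (A.submatrix e f)ᴴ * A.submatrix e f = 1 := by
  rw [Matrix.conjTranspose_submatrix, Matrix.submatrix_mul_equiv, h, Matrix.submatrix_one_equiv]

variable {μ β : Type*} [Fintype μ]

theorem applyAlice_submatrix (A : Matrix μ μ ℂ) (ψ : Unit × μ × β → ℂ) (m : μ) (b : β) :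
    applyAlice (A.submatrix (Equiv.punitProd μ) (Equiv.punitProd μ)) ψ ((), m, b) =
      ∑ t, A m t * ψ ((), t, b) := by
  simp [applyAlice, Fintype.sum_prod_type]

theorem applyBob_submatrix {α β' : Type*} {ν : Type*} (A : Matrix μ μ ℂ) (e : ν × β' ≃ μ)
    (ψ : α × μ × Unit → ℂ) (a : α) (s : ν × β') :
    applyBob (A.submatrix e (Equiv.prodPUnit μ)) ψ (a, s) = ∑ t, A (e s) t * ψ (a, t, ()) := by
  simp [applyBob, Fintype.sum_prod_type]

end Isometry

/-! ### The masked protocol: output distribution and cost -/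

section MaskedProtocol

variable {N : ℕ} {X Y Z : Type*} [Fintype Z]

/-- Alice's operations in the masked protocol: at the first turn the message is masked, at the turn
`n` her mask is removed and the message is dephased. -/
noncomputable def aliceOp (n : ℕ) (a : ℕ → Matrix (Word N) (Word N) ℂ) (r : Word N) (j : ℕ) :
    Matrix (Word N) (Word N) ℂ :=
  if j < n then a j * (if j = 0 then mask r else 1) else dephase r * (mask r)ᴴ

/-- Bob's operations in the masked protocol: at the first turn the message is masked. -/
noncomputable def bobOp (b : ℕ → Matrix (Word N) (Word N) ℂ) (r : Word N) (j : ℕ) :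
    Matrix (Word N) (Word N) ℂ :=
  b j * if j = 0 then mask r else 1

theorem mask_conjTranspose_isometry (r : Word N) : ((mask r)ᴴ)ᴴ * (mask r)ᴴ = 1 := by
  rw [Matrix.conjTranspose_conjTranspose, mask_mul_conjTranspose]

theorem isometry_mul {κ : Type*} [Fintype κ] [DecidableEq κ] {A B : Matrix κ κ ℂ}
    (hA : Aᴴ * A = 1) (hB : Bᴴ * B = 1) : (A * B)ᴴ * (A * B) = 1 := by
  rw [Matrix.conjTranspose_mul, Matrix.mul_assoc, ← Matrix.mul_assoc Aᴴ, hA, Matrix.one_mul, hB]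

theorem aliceOp_isometry {n : ℕ} {a : ℕ → Matrix (Word N) (Word N) ℂ}
    (ha : ∀ j, (a j)ᴴ * a j = 1) (r : Word N) (j : ℕ) :
    (aliceOp n a r j)ᴴ * aliceOp n a r j = 1 := by
  unfold aliceOp
  split_ifs
  · exact isometry_mul (ha j) (mask_isometry r)
  · exact isometry_mul (ha j) (by simp)
  · exact isometry_mul (dephase_isometry r) (mask_conjTranspose_isometry r)

theorem bobOp_isometry {b : ℕ → Matrix (Word N) (Word N) ℂ}
    (hb : ∀ j, (b j)ᴴ * b j = 1) (r : Word N) (j : ℕ) :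
    (bobOp b r j)ᴴ * bobOp b r j = 1 := by
  unfold bobOp
  split_ifs
  · exact isometry_mul (hb j) (mask_isometry r)
  · exact isometry_mul (hb j) (by simp)

/-- The memoryless protocol in which Alice and Bob alternately apply `a j x` and `b j y` to a
message masked by their coins. At the end Alice dephases the message and Bob measures it in the
computational basis. -/
noncomputable def maskedProtocol (n : ℕ) (a : ℕ → X → Matrix (Word N) (Word N) ℂ)
    (b : ℕ → Y → Matrix (Word N) (Word N) ℂ) (ha : ∀ j x, (a j x)ᴴ * a j x = 1)
    (hb : ∀ j y, (b j y)ᴴ * b j y = 1) (dec : Word N → Z) : Protocol X Y Z where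
  n := n
  cA := N
  cB := N
  A _ := Unit
  B _ := Unit
  M _ := Word N
  fintypeA _ := inferInstance
  fintypeB _ := inferInstance
  fintypeM _ := inferInstance
  decEqA _ := inferInstance
  decEqB _ := inferInstance
  decEqM _ := inferInstance
  a₀ := ()
  m₀ := 0
  b₀ := ()
  UA j x r := (aliceOp n (fun j => a j x) (bits r) j).submatrix
    (Equiv.punitProd (Word N)) (Equiv.punitProd (Word N))
  UB j y r := (bobOp (fun j => b j y) (bits r) j).submatrix
    (Equiv.prodPUnit (Word N)) (Equiv.prodPUnit (Word N))
  UA_isometry j x r := submatrix_isometry (aliceOp_isometry (fun j => ha j x) _ j) _ _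
  UB_isometry j y r := submatrix_isometry (bobOp_isometry (fun j => hb j y) _ j) _ _
  G := Unit
  O := Word N
  UF _ r := ((mask (bits r))ᴴ).submatrix (Equiv.punitProd (Word N)) (Equiv.prodPUnit (Word N))
  UF_isometry y r := submatrix_isometry (mask_conjTranspose_isometry (bits r)) _ _
  E z := open scoped Classical in Matrix.diagonal fun w => if dec w = z then 1 else 0
  E_posSemidef z := by
    classical
    refine Matrix.PosSemidef.diagonal fun w => ?_
    split_ifs <;> simp
  E_sum := by
    classical
    ext s t
    by_cases h : s = t
    · subst h; simp [Matrix.sum_apply]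
    · simp [Matrix.sum_apply, h]

variable {n : ℕ} {a : ℕ → X → Matrix (Word N) (Word N) ℂ}
  {b : ℕ → Y → Matrix (Word N) (Word N) ℂ} {ha : ∀ j x, (a j x)ᴴ * a j x = 1}
  {hb : ∀ j y, (b j y)ᴴ * b j y = 1} {dec : Word N → Z}

theorem maskedProtocol_memoryless : (maskedProtocol n a b ha hb dec).Memoryless :=
  ⟨fun _ => Fintype.card_unit, fun _ => Fintype.card_unit⟩

theorem submatrix_unitary {κ μ ν : Type*} [Fintype κ] [Fintype μ] [Fintype ν]
    [DecidableEq κ] [DecidableEq μ] {A : Matrix κ κ ℂ} (h : Aᴴ * A = 1) (e : μ ≃ κ) (f : ν ≃ κ) :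
    A.submatrix e f * (A.submatrix e f)ᴴ = 1 := by
  rw [Matrix.conjTranspose_submatrix, Matrix.submatrix_mul_equiv, mul_eq_one_comm.mp h,
    Matrix.submatrix_one_equiv]

theorem maskedProtocol_isUnitary : (maskedProtocol n a b ha hb dec).IsUnitary :=
  ⟨fun j x _ => submatrix_unitary (aliceOp_isometry (fun j => ha j x) _ j) _ _,
    fun j y _ => submatrix_unitary (bobOp_isometry (fun j => hb j y) _ j) _ _,
    fun _ r => submatrix_unitary (mask_conjTranspose_isometry (bits r)) _ _⟩

theorem maskedProtocol_evenState (x : X) (y : Y) (rA rB : Fin N → Bool) (j : ℕ) (m : Word N) :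
    (maskedProtocol n a b ha hb dec).evenState x y rA rB j ((), m, ()) =
      run (aliceOp n (fun j => a j x) (bits rA)) (bobOp (fun j => b j y) (bits rB)) j m 0 := by
  induction j generalizing m with
  | zero =>
    change (Pi.single ((), (0 : Word N), ()) 1 : Unit × Word N × Unit → ℂ) ((), m, ()) = _
    by_cases h : m = 0
    · subst h
      simp [run]
    · simp [run, h]
  | succ j ih =>
    rw [run, Matrix.mul_apply]
    change applyBob ((bobOp (fun j => b j y) (bits rB) j).submatrix (Equiv.prodPUnit (Word N))
      (Equiv.prodPUnit (Word N))) (applyAlice ((aliceOp n (fun j => a j x) (bits rA) j).submatrix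
      (Equiv.punitProd (Word N)) (Equiv.punitProd (Word N)))
      ((maskedProtocol n a b ha hb dec).evenState x y rA rB j)) ((), m, ()) = _
    refine (applyBob_submatrix _ (Equiv.prodPUnit (Word N)) _ _ _).trans ?_
    refine Finset.sum_congr rfl fun t _ => congrArg _ ?_
    rw [Matrix.mul_apply]
    refine (applyAlice_submatrix _ _ _ _).trans ?_
    exact Finset.sum_congr rfl fun s _ => congrArg _ (ih s)

theorem maskedProtocol_oddState (x : X) (y : Y) (rA rB : Fin N → Bool) (j : ℕ) (m : Word N) :
    (maskedProtocol n a b ha hb dec).oddState x y rA rB j ((), m, ()) =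
      (aliceOp n (fun j => a j x) (bits rA) j *
        run (aliceOp n (fun j => a j x) (bits rA)) (bobOp (fun j => b j y) (bits rB)) j) m 0 := by
  rw [Matrix.mul_apply]
  refine (applyAlice_submatrix _ _ _ _).trans ?_
  exact Finset.sum_congr rfl fun s _ => congrArg _ (maskedProtocol_evenState x y rA rB j s)

theorem maskedProtocol_finalState (x : X) (y : Y) (rA rB : Fin N → Bool) (m : Word N) :
    (maskedProtocol n a b ha hb dec).finalState x y rA rB ((), (), m) =
      ((mask (bits rB))ᴴ * (aliceOp n (fun j => a j x) (bits rA) n *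
        run (aliceOp n (fun j => a j x) (bits rA)) (bobOp (fun j => b j y) (bits rB)) n)) m 0 := by
  rw [Matrix.mul_apply]
  refine (applyBob_submatrix _ (Equiv.punitProd (Word N)) _ _ _).trans ?_
  exact Finset.sum_congr rfl fun s _ => congrArg _ (maskedProtocol_oddState x y rA rB n s)

theorem run_aliceOp_bobOp {a b : ℕ → Matrix (Word N) (Word N) ℂ}
    (ham : ∀ j w, a j * mask w = mask w * a j) (u v : Word N) {j : ℕ} (hj : j ≤ n) :
    run (aliceOp n a u) (bobOp b v) j = run a b j * if j = 0 then 1 else mask v * mask u :=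
  run_masked (fun j => ham j v) (fun _ h => if_pos h) (fun _ _ => rfl) hj

/-- In the last message Alice's mask has been removed and the product of all operations dephased. -/
theorem last_message_apply {a b : ℕ → Matrix (Word N) (Word N) ℂ}
    (ham : ∀ j w, a j * mask w = mask w * a j) (hbm : ∀ j w, b j * mask w = mask w * b j)
    (hn : n ≠ 0) (u v m : Word N) :
    (aliceOp n a u n * run (aliceOp n a u) (bobOp b v) n) m 0 =
      sgn (u ⬝ᵥ m) * (sgn (clif u v + clif v u) * (sgn (clif (v + m) v) *
        run a b n (v + m) 0)) := by
  have hc := run_commute (fun j => ham j v) (fun j => hbm j v) n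
  have hc' := run_commute (fun j => ham j u) (fun j => hbm j u) n
  -- The adjoint mask passes the run as well, so it meets `mask v * mask u` directly and
  -- `mask_conj_mask` applies. Both masks are present there because `n ≠ 0`.
  have h : (mask u)ᴴ * run a b n = run a b n * (mask u)ᴴ := by
    calc (mask u)ᴴ * run a b n = (mask u)ᴴ * (run a b n * mask u) * (mask u)ᴴ := by
          rw [Matrix.mul_assoc, Matrix.mul_assoc, mask_mul_conjTranspose, Matrix.mul_one]
      _ = run a b n * (mask u)ᴴ := by
          rw [hc', ← Matrix.mul_assoc, mask_isometry, Matrix.one_mul]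
  rw [run_aliceOp_bobOp ham u v le_rfl, if_neg hn, aliceOp, if_neg (lt_irrefl n),
    Matrix.mul_assoc, dephase_mul_apply, ← Matrix.mul_assoc (mask u)ᴴ, h, Matrix.mul_assoc,
    mask_conj_mask, Matrix.mul_smul, Matrix.smul_apply, hc, mask_mul_apply, smul_eq_mul]

theorem maskedProtocol_outProb (ham : ∀ j x w, a j x * mask w = mask w * a j x)
    (hbm : ∀ j y w, b j y * mask w = mask w * b j y) (hn : n ≠ 0) (x : X) (y : Y) (z : Z)
    {p : Z → ℝ} {h : Z → Word N} (hdec : ∀ z, dec (h z) = z)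
    (hp : ∀ s, Complex.normSq (run (fun j => a j x) (fun j => b j y) n s 0) =
      ∑ z, if s = h z then p z else 0) :
    (maskedProtocol n a b ha hb dec).outProb x y z = p z := by
  classical
  have key : ∀ (rA rB : Fin N → Bool) (φ : Word N → ℂ), (∀ m, φ m =
      ((mask (bits rB))ᴴ * (aliceOp n (fun j => a j x) (bits rA) n *
        run (aliceOp n (fun j => a j x) (bits rA)) (bobOp (fun j => b j y) (bits rB)) n)) m 0) →
      (star φ ⬝ᵥ ((Matrix.diagonal fun w => if dec w = z then 1 else 0) *ᵥ φ)).re = p z := by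
    intro rA rB φ hφ
    -- Bob's unmasking undoes the shift of the words, and every remaining coin dependence is a sign,
    -- which the modulus does not see.
    have hsq : ∀ m, star (φ m) * φ m = ((∑ z, if m = h z then p z else 0 : ℝ) : ℂ) := by
      intro m
      rw [hφ, mask_conjTranspose_mul_apply,
        last_message_apply (fun j => ham j x) (fun j => hbm j y) hn, Word.add_add_cancel, ← hp m,
        Complex.normSq_eq_conj_mul_self]
      have e : ∀ (s : ZMod 2) (w : ℂ), star (sgn s * w) * (sgn s * w) = star w * w := by
        intro s w
        rw [star_mul, star_sgn]
        linear_combination (star w * w) * sgn_mul_self s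
      rw [e, e, e, e]
      rfl
    have h1 : ∀ m : Word N, star (φ m) * ((if dec m = z then 1 else 0) * φ m) =
        ((∑ z', if m = h z' then (if z' = z then p z' else 0) else 0 : ℝ) : ℂ) := by
      intro m
      rw [mul_left_comm, hsq, ← Complex.ofReal_one, ← Complex.ofReal_zero, ← apply_ite,
        ← Complex.ofReal_mul, Finset.mul_sum]
      congr 1
      refine Finset.sum_congr rfl fun z' _ => ?_
      by_cases hm : m = h z'
      · subst hm
        simp [hdec]
      · simp [hm]
    simp only [dotProduct, Matrix.mulVec_diagonal, Pi.star_apply, h1, ← Complex.ofReal_sum,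
      Complex.ofReal_re]
    rw [Finset.sum_comm]
    simp
  have h3 : (maskedProtocol n a b ha hb dec).outProb x y z =
      (∑ rA : Fin N → Bool, ∑ rB : Fin N → Bool, ∑ _ : Unit, ∑ _ : Unit, p z) /
        (2 ^ N * 2 ^ N) := by
    refine congrArg (· / _) ?_
    exact Finset.sum_congr rfl fun rA _ => Finset.sum_congr rfl fun rB _ =>
      Finset.sum_congr rfl fun _ _ => Finset.sum_congr rfl fun _ _ =>
        key rA rB _ (maskedProtocol_finalState x y rA rB)
  rw [h3]
  simp
  field_simp

variable [Fintype X] [DecidableEq X] [Fintype Y] [DecidableEq Y]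

theorem classicalCondMutualInfo_uniform {β γ : Type*} [Fintype β] [Fintype γ]
    (q : β × γ → ℝ) :
    classicalCondMutualInfo (fun s : Word N × β × γ => q s.2 * ((2 : ℝ) ^ N)⁻¹) = 0 := by
  rw [funext fun s : Word N × β × γ => mul_comm (q s.2) ((2 : ℝ) ^ N)⁻¹]
  refine classicalCondMutualInfo_of_indep (fun _ => ((2 : ℝ) ^ N)⁻¹) ?_ q
  rw [Finset.sum_const, Finset.card_univ, card_word]
  simp

theorem maskedProtocol_oddTerm_eq_zero (ham : ∀ j x w, a j x * mask w = mask w * a j x)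
    (μ : X × Y → ℝ) {j : ℕ} (hj : j < n) :
    (maskedProtocol n a b ha hb dec).oddTerm μ j = 0 := by
  rw [Protocol.oddTerm_eq_of_diagonal _ μ j (fun _ _ _ _ _ => ((2 : ℝ) ^ N)⁻¹)]
  · exact classicalCondMutualInfo_uniform (N := N) (β := X) (γ := Y × (Fin N → Bool) × Unit)
      fun s => μ (s.1, s.2.1) / 2 ^ N
  · intro x y (rB : Fin N → Bool) (m : Word N) b₁ (m' : Word N) b₁'
    have hs : ∀ rA : Fin N → Bool, aliceOp n (fun j => a j x) (bits rA) j *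
        run (aliceOp n (fun j => a j x) (bits rA)) (bobOp (fun j => b j y) (bits rB)) j =
        (a j x * run (fun j => a j x) (fun j => b j y) j) *
          if j = 0 then mask (bits rA) else mask (bits rB) * mask (bits rA) := by
      intro rA
      rw [run_aliceOp_bobOp (fun j => ham j x) _ _ hj.le, aliceOp, if_pos hj]
      rcases Nat.eq_zero_or_pos j with rfl | h
      · simp [run]
      · simp [h.ne', Matrix.mul_assoc]
    -- In round 1 only Alice's mask is present; later Bob's fixed mask additionally translates the
    -- words and gives a sign. In both cases her coins permute the basis.
    have h := sum_mask_average
      (isometry_mul (ha j x) (run_isometry (fun j => ha j x) (fun j => hb j y) j))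
      (Q := fun rA => if j = 0 then mask (bits rA) else mask (bits rB) * mask (bits rA))
      (ε := fun rA => if j = 0 then 1 else sgn (clif (bits rA) (bits rB)))
      (bits.trans (if j = 0 then Equiv.refl _ else Equiv.addLeft (bits rB)))
      (by intro r; split_ifs <;> simp)
      (by
        intro r s
        split_ifs <;> simp_all [mask_apply_zero, mask_mul_mask_apply_zero]) m m'
    simp only [← hs] at h
    refine Eq.trans ?_ (h.trans ?_)
    · refine Finset.sum_congr rfl fun rA _ => (Fintype.sum_unique (ι := Unit) _).trans ?_
      exact congrArg₂ (fun s t => s * star t) (maskedProtocol_oddState x y rA rB j m)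
        (maskedProtocol_oddState x y rA rB j m')
    · have e : (2 : ℝ) ^ N * (2 ^ N)⁻¹ = 1 := mul_inv_cancel₀ (by positivity)
      change (if m = m' then (1 : ℂ) else 0) =
        if m = m' ∧ b₁ = b₁' then ((((2 : ℝ) ^ N * (2 ^ N)⁻¹ : ℝ)) : ℂ) else 0
      rw [e]
      have : b₁ = b₁' := Subsingleton.elim (α := Unit) _ _
      simp [this]

theorem maskedProtocol_evenTerm_eq_zero (ham : ∀ j x w, a j x * mask w = mask w * a j x)
    (μ : X × Y → ℝ) {j : ℕ} (hj : j < n) :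
    (maskedProtocol n a b ha hb dec).evenTerm μ (j + 1) = 0 := by
  rw [Protocol.evenTerm_eq_of_diagonal _ μ (j + 1) (fun _ _ _ _ _ => ((2 : ℝ) ^ N)⁻¹)]
  · exact classicalCondMutualInfo_uniform (N := N) (β := Y) (γ := X × (Fin N → Bool) × Unit)
      fun s => μ (s.2.1, s.1) / 2 ^ N
  · intro x y (rA : Fin N → Bool) (m : Word N) b₁ (m' : Word N) b₁'
    -- Here Bob is the sender: his coins are averaged with Alice's fixed, and he has already masked
    -- the message by round `2 * (j + 1)`.
    have h := sum_mask_average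
      (run_isometry (fun j => ha j x) (fun j => hb j y) (j + 1))
      (Q := fun rB => mask (bits rB) * mask (bits rA))
      (ε := fun rB => sgn (clif (bits rA) (bits rB)))
      (bits.trans (Equiv.addRight (bits rA)))
      (by intro r; simp)
      (by
        intro r s
        exact mask_mul_mask_apply_zero _ _ _) m m'
    have hs : ∀ rB : Fin N → Bool,
        run (fun j => a j x) (fun j => b j y) (j + 1) * (mask (bits rB) * mask (bits rA)) =
        run (aliceOp n (fun j => a j x) (bits rA)) (bobOp (fun j => b j y) (bits rB)) (j + 1) := by
      intro rB
      rw [run_aliceOp_bobOp (fun j => ham j x) _ _ hj, if_neg (Nat.succ_ne_zero j)]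
    simp only [hs] at h
    refine Eq.trans ?_ (h.trans ?_)
    · refine Finset.sum_congr rfl fun rB _ => (Fintype.sum_unique (ι := Unit) _).trans ?_
      exact congrArg₂ (fun s t => s * star t) (maskedProtocol_evenState x y rA rB (j + 1) m)
        (maskedProtocol_evenState x y rA rB (j + 1) m')
    · have e : (2 : ℝ) ^ N * (2 ^ N)⁻¹ = 1 := mul_inv_cancel₀ (by positivity)
      change (if m = m' then (1 : ℂ) else 0) =
        if m = m' ∧ b₁ = b₁' then ((((2 : ℝ) ^ N * (2 ^ N)⁻¹ : ℝ)) : ℂ) else 0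
      rw [e]
      have : b₁ = b₁' := Subsingleton.elim (α := Unit) _ _
      simp [this]

theorem maskedProtocol_last_oddTerm (ham : ∀ j x w, a j x * mask w = mask w * a j x)
    (hbm : ∀ j y w, b j y * mask w = mask w * b j y) (hn : n ≠ 0)
    {p : X → Y → Z → ℝ} {h : Z → Word N} (hinj : Function.Injective h)
    (hp : ∀ x y s, Complex.normSq (run (fun j => a j x) (fun j => b j y) n s 0) =
      ∑ z, if s = h z then p x y z else 0) (μ : X × Y → ℝ) :
    (maskedProtocol n a b ha hb dec).oddTerm μ n =
      classicalCondMutualInfo fun s : Z × X × Y => μ s.2 * p s.2.1 s.2.2 s.1 := by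
  -- The received word still carries Bob's mask, so the unmasked amplitude is read at `bits rB + m`.
  -- As Bob's coins are conditioned on, this shift is an injective relabelling of the outcome.
  rw [Protocol.oddTerm_eq_of_diagonal _ μ n (fun x y (rB : Fin N → Bool) (m : Word N) _ =>
    Complex.normSq (run (fun j => a j x) (fun j => b j y) n (bits rB + m) 0))]
  · have hg : ∀ r : Fin N → Bool, Function.Injective fun z => bits r + h z :=
      fun r z w e => hinj (add_left_cancel e)
    rw [← classicalCondMutualInfo_relabel (σ := Fin N → Bool) (δ := Unit)
      (fun s : Z × X × Y => μ s.2 * p s.2.1 s.2.2 s.1) hg]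
    refine congrArg classicalCondMutualInfo ?_
    refine funext fun ⟨(m : Word N), x, y, (r : Fin N → Bool), d⟩ => ?_
    change μ (x, y) / 2 ^ N *
      Complex.normSq (run (fun j => a j x) (fun j => b j y) n (bits r + m) 0) = _
    rw [hp, card_coins, div_mul_eq_mul_div, div_eq_inv_mul, Finset.mul_sum]
    push_cast
    congr 1
    refine Finset.sum_congr rfl fun z _ => ?_
    have e : bits r + m = h z ↔ m = bits r + h z := by
      constructor
      · rintro e
        rw [← e, Word.add_add_cancel]
      · rintro rfl
        exact Word.add_add_cancel _ _
    simp only [e, mul_ite, mul_zero]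
  · intro x y (rB : Fin N → Bool) (m : Word N) b₁ (m' : Word N) b₁'
    have hs : ∀ rA : Fin N → Bool,
        (aliceOp n (fun j => a j x) (bits rA) n * run (aliceOp n (fun j => a j x) (bits rA))
          (bobOp (fun j => b j y) (bits rB)) n) m 0 *
        star ((aliceOp n (fun j => a j x) (bits rA) n * run (aliceOp n (fun j => a j x) (bits rA))
          (bobOp (fun j => b j y) (bits rB)) n) m' 0) =
        sgn (bits rA ⬝ᵥ (m + m')) * (sgn (clif (bits rB + m) (bits rB)) *
          run (fun j => a j x) (fun j => b j y) n (bits rB + m) 0 *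
          star (sgn (clif (bits rB + m') (bits rB)) *
          run (fun j => a j x) (fun j => b j y) n (bits rB + m') 0)) := by
      intro rA
      rw [last_message_apply (fun j => ham j x) (fun j => hbm j y) hn,
        last_message_apply (fun j => ham j x) (fun j => hbm j y) hn, dotProduct_add,
        sgn_add (bits rA ⬝ᵥ m)]
      simp only [star_mul, star_sgn]
      linear_combination (sgn (bits rA ⬝ᵥ m) * sgn (bits rA ⬝ᵥ m') *
        sgn (clif (bits rB + m) (bits rB)) *
          run (fun j => a j x) (fun j => b j y) n (bits rB + m) 0 *
          (star (run (fun j => a j x) (fun j => b j y) n (bits rB + m') 0) *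
           sgn (clif (bits rB + m') (bits rB)))) *
        sgn_mul_self (clif (bits rA) (bits rB) + clif (bits rB) (bits rA))
    refine Eq.trans (Finset.sum_congr rfl fun rA _ => (Fintype.sum_unique (ι := Unit) _).trans
      ((congrArg₂ (fun s t => s * star t) (maskedProtocol_oddState x y rA rB n m)
        (maskedProtocol_oddState x y rA rB n m')).trans (hs rA))) ?_
    change ∑ rA : Fin N → Bool, sgn (bits rA ⬝ᵥ (m + m')) * _ =
      if m = m' ∧ b₁ = b₁' then (((2 : ℝ) ^ N * Complex.normSq (run (fun j => a j x) (fun j => b j y) n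
        (bits rB + m) 0) : ℝ) : ℂ) else 0
    -- The sign from removing Alice's mask occurs twice and has cancelled, so her coins survive only
    -- as a character of `m + m'`. Orthogonality kills all coherences.
    rw [← Finset.sum_mul, Equiv.sum_comp bits fun w => sgn (w ⬝ᵥ (m + m')), sum_sgn_dotProduct]
    have hb₁ : b₁ = b₁' := Subsingleton.elim (α := Unit) _ _
    by_cases hm : m = m'
    · subst hm
      rw [if_pos (Word.add_self m), if_pos ⟨rfl, hb₁⟩, star_mul, star_sgn, Complex.ofReal_mul,
        Complex.normSq_eq_conj_mul_self]
      push_cast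
      change _ = 2 ^ N * (star (run (fun j => a j x) (fun j => b j y) n (bits rB + m) 0) * _)
      linear_combination (2 ^ N * run (fun j => a j x) (fun j => b j y) n (bits rB + m) 0 *
        star (run (fun j => a j x) (fun j => b j y) n (bits rB + m) 0)) *
        sgn_mul_self (clif (bits rB + m) (bits rB))
    · have : m + m' ≠ 0 := fun e => hm (by rw [← Word.add_add_cancel m m', e, add_zero])
      rw [if_neg this, if_neg (fun e => hm e.1), zero_mul]

theorem maskedProtocol_CIC (ham : ∀ j x w, a j x * mask w = mask w * a j x)
    (hbm : ∀ j y w, b j y * mask w = mask w * b j y) (hn : n ≠ 0)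
    {p : X → Y → Z → ℝ} {h : Z → Word N} (hinj : Function.Injective h)
    (hp : ∀ x y s, Complex.normSq (run (fun j => a j x) (fun j => b j y) n s 0) =
      ∑ z, if s = h z then p x y z else 0) (μ : X × Y → ℝ) :
    (maskedProtocol n a b ha hb dec).CIC μ =
      classicalCondMutualInfo fun s : Z × X × Y => μ s.2 * p s.2.1 s.2.2 s.1 := by
  have hn' : (maskedProtocol n a b ha hb dec).n = n := rfl
  rw [Protocol.CIC, hn', Finset.sum_range_succ,
    maskedProtocol_last_oddTerm ham hbm hn hinj hp μ,
    Finset.sum_eq_zero fun j hj => maskedProtocol_oddTerm_eq_zero ham μ (Finset.mem_range.mp hj),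
    Finset.sum_eq_zero fun j hj => maskedProtocol_evenTerm_eq_zero ham μ (Finset.mem_range.mp hj)]
  ring

end MaskedProtocol

/-! ### Realising an arbitrary stochastic kernel -/

/-- Every stochastic map with finite inputs and outputs is the output map of a memoryless protocol
with unitary operations that reveals nothing but the output. -/
theorem exists_memoryless_protocol {X Y Z : Type*} [Fintype X] [DecidableEq X]
    [Fintype Y] [DecidableEq Y] [Nonempty X] [Nonempty Y] [Fintype Z] {p : X → Y → Z → ℝ}
    (hp0 : ∀ x y z, 0 ≤ p x y z) (hp1 : ∀ x y, ∑ z, p x y z = 1) :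
    ∃ Q : Protocol X Y Z, Q.Memoryless ∧ Q.IsUnitary ∧ (∀ x y z, Q.outProb x y z = p x y z) ∧
      ∀ μ : X × Y → ℝ, Q.CIC μ =
        classicalCondMutualInfo fun s : Z × X × Y => μ s.2 * p s.2.1 s.2.2 s.1 := by
  obtain ⟨x₀⟩ := ‹Nonempty X›
  obtain ⟨y₀⟩ := ‹Nonempty Y›
  -- The decoder `Function.invFun h` needs a default outcome for words that encode none; one exists
  -- since an empty sum cannot be `1`.
  have : Nonempty Z := by
    by_contra hZ
    rw [not_nonempty_iff] at hZ
    simpa using hp1 x₀ y₀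
  let idx : Y → ℕ := fun y => Fintype.equivFin Y y
  have hidx : Function.Injective idx := Fin.val_injective.comp (Fintype.equivFin Y).injective
  have : Nonempty Y := ⟨y₀⟩
  let w : ℕ → Y := Function.invFun idx
  have hw : ∀ y, w (idx y) = y := Function.leftInverse_invFun hidx
  -- Generator `0` is the distinguished one; the outcomes occupy the successors.
  let f : Fin (Fintype.card Z + 1) := 0
  let g : Z → Fin (Fintype.card Z + 1) := fun z => (Fintype.equivFin Z z).succ
  have hg : Function.Injective g :=
    (Fin.succ_injective _).comp (Fintype.equivFin Z).injective
  have hf : ∀ z, f ≠ g z := fun z => (Fin.succ_ne_zero _).symm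
  let c : X → Y → Z → ℝ := fun x y z => √(p x y z)
  have hc2 : ∀ x y z, c x y z ^ 2 = p x y z := fun x y z => Real.sq_sqrt (hp0 x y z)
  have hc : ∀ x y, ∑ z, c x y z ^ 2 = 1 := by
    intro x y
    simp only [hc2, hp1]
  let h : Z → Word (Fintype.card Z + 1) := fun z => Pi.single f 1 + Pi.single (g z) 1
  have hinj : Function.Injective h := by
    intro z z' e
    have e' := congrFun (add_left_cancel e) (g z)
    by_contra hne
    simp [hg.ne hne] at e'
  have hrun : ∀ x y s, Complex.normSq (run (fun j => aliceRotor f g c w j x)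
      (fun j => bobGen f idx j y) (2 * Fintype.card Y) s 0) =
      ∑ z, if s = h z then p x y z else 0 := by
    intro x y s
    rw [run_aliceRotor_bobGen hf hg hc hw, if_pos (Fintype.equivFin Y y).2,
      normSq_gen_mul_cliffordVector_apply_zero f hg]
    simp only [hc2, h]
  have hn : 2 * Fintype.card Y ≠ 0 := by simp
  -- Two turns for each possible input of Bob; the turn with index `2 * Fintype.card Y` is Alice's
  -- unmasking and dephasing.
  refine ⟨maskedProtocol (2 * Fintype.card Y) (aliceRotor f g c w) (bobGen f idx)
    (aliceRotor_isometry hf hg hc) bobGen_isometry (Function.invFun h),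
    maskedProtocol_memoryless, maskedProtocol_isUnitary, fun x y z => ?_, fun μ => ?_⟩
  · exact maskedProtocol_outProb aliceRotor_mul_mask bobGen_mul_mask hn x y z
      (Function.leftInverse_invFun hinj) (hrun x y)
  · exact maskedProtocol_CIC aliceRotor_mul_mask bobGen_mul_mask hn hinj hrun μ

end QComm

theorem theorem2 {X Y Z : Type*} [Fintype X] [DecidableEq X] [Nonempty X]
    [Fintype Y] [DecidableEq Y] [Nonempty Y] [Fintype Z]
    (P : QComm.Protocol X Y Z) :
    ∃ P' : QComm.Protocol X Y Z,
      P'.Memoryless ∧ P'.IsUnitary ∧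
      (∀ x y z, P'.outProb x y z = P.outProb x y z) ∧
      ∀ μ : X × Y → ℝ, μ ∈ stdSimplex ℝ (X × Y) →
        P'.CIC μ = QComm.classicalCondMutualInfo (P.outJoint μ) := by
  obtain ⟨Q, h1, h2, h3, h4⟩ := QComm.exists_memoryless_protocol P.outProb_nonneg P.sum_outProb
  exact ⟨Q, h1, h2, h3, fun μ _ => h4 μ⟩
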